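/- Notation. For real $x$ let $\|x\|$ be the distance from $x$ to the nearest integer. For a sequence $(x_n)_{n\ge 1}$ in $[0,1)$, $s\ge 0$ and $N\ge 1$ put $$R(s,N)=\frac1N\,\#\{1\le i\ne j\le N:\ \|x_i-x_j\|\le s/N\};$$ the pair correlations of $(x_n)$ are Poissonian if $R(s,N)\to 2s$ as $N\to\infty$ for every $s\ge 0$. A strictly increasing sequence $(a_n)_{n\ge1}$ of positive integers has the metric pair correlation property if the pair correlations of $(a_n\alpha \bmod 1)_{n\ge1}$ are Poissonian for Lebesgue-almost every real $\alpha$. Let $A_N=\{a_1,\dots,a_N\}$ and let $E(A_N)=\#\{n_1,n_2,n_3,n_4\le N:\ a_{n_1}+a_{n_2}=a_{n_3}+a_{n_4}\}$ be its additive energy. Theorem. (1) For every $\varepsilon>0$ there is a strictly increasing sequence $(a_n)_{n\ge1}$ of positive integers which has the metric pair correlation property and for which there is a constant $c>0$ with $$E(A_N)\ \ge\ c\,\frac{N^3}{(\log N)^{3/4+\varepsilon}}\qquad\text{for all } N\ge 2.$$ (2) Moreover, there is no Khintchine-type threshold for the metric pair correlation property in terms of the additive energy (negative answer to the "Fundamental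 Question" of Bloom, Chow, Gafni and Walker): there are a strictly increasing sequence $(a_n)_{n\ge1}$ of positive integers and a weakly decreasing function $\psi:\mathbb{Z}_{\ge1}\to[0,1]$ such that $E(A_N)$ is of order $N^3\psi(N)$, i.e. $c\,N^3\psi(N)\le E(A_N)\le C\,N^3\psi(N)$ for all $N\ge1$ with constants $c,C>0$, such that $\sum_{N\ge1}\psi(N)/N$ diverges, and such that $(a_n)$ nevertheless has the metric pair correlation property. -/

import Mathlib

open Filter Topology MeasureTheory

noncomputable section

/-- The distance `‖x‖` of a real number `x` to the nearest integer. -/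
def distNearestInt (x : ℝ) : ℝ := |x - round x|

/-- The pair correlation function of the first `N` terms `x 0, …, x (N - 1)` of a sequence:
`R(s, N) = (1 / N) * #{(i, j) : i ≠ j, ‖x i - x j‖ ≤ s / N}`. -/
def pairCorrelation (x : ℕ → ℝ) (s : ℝ) (N : ℕ) : ℝ :=
  (((Finset.range N).offDiag.filter
    fun p : ℕ × ℕ => distNearestInt (x p.1 - x p.2) ≤ s / N).card : ℝ) / N

/-- The distribution of the pair correlations of the sequence `x` is Poissonian. -/
def PoissonianPairCorrelations (x : ℕ → ℝ) : Prop :=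
  ∀ s : ℝ, 0 ≤ s → Tendsto (fun N : ℕ => pairCorrelation x s N) atTop (𝓝 (2 * s))

/-- The sequence of integers `a` has the metric pair correlation property: the pair correlations
of `(a n * α) mod 1` are Poissonian for Lebesgue-almost every real number `α`. -/
def MetricPairCorrelationProperty (a : ℕ → ℕ) : Prop :=
  ∀ᵐ α : ℝ ∂volume, PoissonianPairCorrelations fun n => Int.fract ((a n : ℝ) * α)

/-- The set `A_N` of the first `N` terms of the sequence `a` (indexed from `0`). -/
def initialSegment (a : ℕ → ℕ) (N : ℕ) : Finset ℕ := (Finset.range N).image a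

/-- The additive energy of the set of the first `N` terms of the sequence `a`, that is, the
number of quadruples in this set with `x₁ + x₂ = x₃ + x₄`. -/
def initialEnergy (a : ℕ → ℕ) (N : ℕ) : ℕ :=
  Finset.addEnergy (initialSegment a N) (initialSegment a N)

end

/-! One sequence serves both parts. Its `k`-th dyadic block opens with a generalized arithmetic
progression of rank 40 and side `m`, where `m ^ 40` is about `2 ^ k / k ^ (1/4)`. The remaining
members of the block are independent of everything else. All generators are integers `Q i` growing
so fast that the only relations with controlled coefficients are the formal ones in the free abelian
group. Hence the energy is, up to constants, that of the last complete progression, `(2 ^ k) ^ 3 / k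
^ (3/4)`. So it has order `N ^ 3 * ψ N` with `ψ N = (1 + log N) ^ (-3/4)`, and `∑ ψ N / N` diverges.

For the pair correlations, pairs of indices are split by whether they lie in a common progression.
If they do not (`latePairs`), two differences are linearly independent unless they come from the
same unordered pair, so the counts have small variance. A second moment bound gives convergence
along `N = j ^ 3` for rational `s`, and monotonicity extends it to all `N` and `s`
(`ae_tendsto_latePairs`, `tendsto_closePairs_of_cubes`).

Pairs inside one progression have negligible expectation, but not summably so. Here rank is
exploited (`volume_many_small_le`). Take a prime `p` of size about `k ^ (1/40)`. If more than `p ^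
4` digit differences had multiples within `p / 2 ^ k` of an integer, then modulo `p` either two of
them agree or five are linearly independent. The first event has measure `O((m/p) ^ 40 * p / 2 ^
k)`, the second `O((m ^ 40 * p / 2 ^ k) ^ 5)`, and both are `O(k ^ (-9/8))`. By Borel–Cantelli there
are eventually at most `p ^ 4` such differences. Each accounts for at most `m ^ 40` pairs, and `m ^
40 * p ^ 4 = o(2 ^ k)`. -/

/-! ### Fourier analysis on the circle: quasi-independence of dilates. -/

theorem volume_real_univ_unitAddCircle : (volume : Measure UnitAddCircle).real Set.univ = 1 := by
  simp [Measure.real, AddCircle.measure_univ]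

theorem integral_fourier_unitAddCircle (n : ℤ) :
    ∫ x : UnitAddCircle, fourier n x = if n = 0 then 1 else 0 := by
  have h := congrFun (fourierCoeff_fourier (T := 1) n) 0
  have h2 : fourierCoeff (T := 1) (fourier n) 0 = ∫ x : UnitAddCircle, fourier n x := by
    rw [fourierCoeff, AddCircle.integral_haarAddCircle]
    simp
  rw [← h2, h, Pi.single_apply]
  simp [eq_comm]

/-- Trigonometric majorants of the indicator function of an arc. -/
theorem exists_trig_majorant {η ε : ℝ} (hη : 0 ≤ η) (hε : 0 < ε) :
    ∃ (c : ℤ →₀ ℂ) (y : UnitAddCircle → ℝ), (∀ x, 0 ≤ y x) ∧ (∀ x, ‖x‖ ≤ η → 1 ≤ y x) ∧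
      (∀ x, ∑ n ∈ c.support, c n * fourier n x = (y x : ℂ)) ∧ ∃ c₀ : ℝ, c 0 = (c₀ : ℂ) ∧
        0 ≤ c₀ ∧ c₀ ≤ 2 * η + ε := by
  -- Widening the arc by `ρ` on both sides costs `2 * ρ` in measure; the approximation error and the
  -- upward shift cost `ρ` each.
  obtain ⟨ρ, hρ0, hρ⟩ : ∃ ρ : ℝ, 0 < ρ ∧ 4 * ρ = ε := ⟨ε / 4, by positivity, by ring⟩
  let g : UnitAddCircle → ℝ := fun x => max 0 (min 1 (1 + (η - ‖x‖) / ρ))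
  have hgc : Continuous g := by fun_prop
  let G : C(UnitAddCircle, ℂ) := ⟨fun x => (g x : ℂ), by fun_prop⟩
  have hG : G ∈ (fourierSubalgebra (T := 1)).topologicalClosure := by
    rw [fourierSubalgebra_closure_eq_top]; trivial
  obtain ⟨p, hp, hpG⟩ := Metric.mem_closure_iff.1
    (show G ∈ closure ((fourierSubalgebra (T := 1) : Set C(UnitAddCircle, ℂ))) from hG) ρ hρ0
  -- Taking the real part of the approximating polynomial makes it real-valued, and adding the
  -- approximation error `ρ` lifts it above `g`.
  have hf : (1 / 2 : ℂ) • (p + star p) + algebraMap ℂ _ (ρ : ℂ) ∈ fourierSubalgebra (T := 1) :=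
    add_mem (SMulMemClass.smul_mem _ (add_mem hp (star_mem hp))) (algebraMap_mem _ _)
  set f := (1 / 2 : ℂ) • (p + star p) + algebraMap ℂ C(UnitAddCircle, ℂ) (ρ : ℂ) with hfdef
  have hf' : f ∈ Submodule.span ℂ (Set.range (fourier (T := 1))) := by
    rw [← fourierSubalgebra_coe]; exact hf
  obtain ⟨c, hc⟩ := Finsupp.mem_span_range_iff_exists_finsupp.1 hf'
  have hfx : ∀ x, f x = (((p x).re + ρ : ℝ) : ℂ) := by
    intro x
    have : f x = (1 / 2 : ℂ) * (p x + starRingEnd ℂ (p x)) + ρ := by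
      simp [hfdef]
    rw [this, Complex.add_conj]
    push_cast; ring
  have hcx : ∀ x, ∑ n ∈ c.support, c n * fourier n x = f x := by
    intro x
    rw [← hc, Finsupp.sum, ContinuousMap.sum_apply]
    simp
  have hre : ∀ x, |(p x).re - g x| ≤ ρ := by
    intro x
    have h1 : ‖G x - p x‖ < ρ := by
      rw [← dist_eq_norm]
      exact (ContinuousMap.dist_apply_le_dist x).trans_lt hpG
    have h2 : |(G x - p x).re| ≤ ‖G x - p x‖ := Complex.abs_re_le_norm _
    have h3 : (G x - p x).re = g x - (p x).re := by simp [G]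
    rw [h3, abs_sub_comm] at h2
    linarith
  have hy0 : ∀ x, 0 ≤ (p x).re + ρ := fun x => by
    have h := (abs_le.1 (hre x)).1
    have : 0 ≤ g x := le_max_left _ _
    linarith
  have hint : ∫ x, f x = c 0 := by
    calc ∫ x, f x = ∫ x : UnitAddCircle, ∑ n ∈ c.support, c n * fourier n x := by
          exact integral_congr_ae (Eventually.of_forall fun x => (hcx x).symm)
      _ = ∑ n ∈ c.support, ∫ x : UnitAddCircle, c n * fourier n x := by
          apply integral_finsetSum
          intro n _
          exact (Continuous.integrable_of_hasCompactSupport (by fun_prop)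
            (HasCompactSupport.of_compactSpace _))
      _ = ∑ n ∈ c.support, c n * (if n = 0 then 1 else 0) := by
          refine Finset.sum_congr rfl fun n _ => ?_
          rw [integral_const_mul, integral_fourier_unitAddCircle]
      _ = c 0 := by simp +contextual
  have hint2 : ∫ x, f x = ((∫ x, ((p x).re + ρ) : ℝ) : ℂ) := by
    simp_rw [hfx]
    exact integral_ofReal
  have hcont : Continuous fun x => (p x).re + ρ :=
    (Complex.continuous_re.comp p.continuous).add continuous_const
  refine ⟨c, fun x => (p x).re + ρ, hy0, ?_, fun x => by rw [hcx, hfx], _, hint.symm.trans hint2,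
    integral_nonneg hy0, ?_⟩
  · intro x hx
    have h := (abs_le.1 (hre x)).1
    have : 1 ≤ g x := by
      apply le_max_of_le_right
      apply le_min le_rfl
      have : 0 ≤ (η - ‖x‖) / ρ := div_nonneg (by linarith) hρ0.le
      linarith
    linarith
  · have hle : ∀ x, (p x).re + ρ ≤
        (Metric.closedBall (0 : UnitAddCircle) (η + ρ)).indicator 1 x + 2 * ρ := by
      intro x
      have h := (abs_le.1 (hre x)).2
      have : g x ≤ (Metric.closedBall (0 : UnitAddCircle) (η + ρ)).indicator 1 x := by
        by_cases hx : ‖x‖ ≤ η + ρ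
        · rw [Set.indicator_of_mem (by simpa using hx)]
          exact max_le (by simp) (min_le_left _ _)
        · rw [Set.indicator_of_notMem (by simpa using hx)]
          refine max_le le_rfl ((min_le_right _ _).trans ?_)
          have : (η - ‖x‖) / ρ ≤ -1 := by
            rw [div_le_iff₀ hρ0]; linarith
          linarith
      linarith
    have hms : MeasurableSet (Metric.closedBall (0 : UnitAddCircle) (η + ρ)) :=
      Metric.isClosed_closedBall.measurableSet
    have hi1 : Integrable
        ((Metric.closedBall (0 : UnitAddCircle) (η + ρ)).indicator (1 : UnitAddCircle → ℝ)) :=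
      (integrable_indicator_iff hms).2 (integrableOn_const (by finiteness))
    refine (integral_mono (hcont.integrable_of_hasCompactSupport
      (HasCompactSupport.of_compactSpace _)) (hi1.add (integrable_const _)) hle).trans ?_
    have e1 : ∫ x, ((Metric.closedBall (0 : UnitAddCircle) (η + ρ)).indicator
        (1 : UnitAddCircle → ℝ) x + 2 * ρ)
        = volume.real (Metric.closedBall (0 : UnitAddCircle) (η + ρ)) + 2 * ρ := by
      rw [integral_add hi1 (integrable_const _), integral_indicator_one hms, integral_const,
        volume_real_univ_unitAddCircle]
      simp
    refine e1.trans_le ?_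
    rw [Measure.real, AddCircle.volume_closedBall,
      ENNReal.toReal_ofReal (by positivity)]
    have := min_le_right (1 : ℝ) (2 * (η + ρ))
    linarith

theorem volume_zsmul_norm_le {b : ℤ} (hb : b ≠ 0) {η : ℝ} (hη : 0 ≤ η) :
    volume.real {β : UnitAddCircle | ‖b • β‖ ≤ η} = min 1 (2 * η) := by
  have h := (Measure.measurePreserving_zsmul (volume : Measure UnitAddCircle) hb)
  have hm : MeasurableSet (Metric.closedBall (0 : UnitAddCircle) η) :=
    Metric.isClosed_closedBall.measurableSet
  have e : {β : UnitAddCircle | ‖b • β‖ ≤ η} =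
      (fun β : UnitAddCircle => b • β) ⁻¹' Metric.closedBall 0 η := by
    ext; simp
  rw [e, Measure.real, h.measure_preimage hm.nullMeasurableSet, AddCircle.volume_closedBall,
    ENNReal.toReal_ofReal (by positivity)]

/-- Integer multiples of a uniformly distributed point of the circle that satisfy no linear
relation with small coefficients behave like independent ones. -/
theorem exists_relation_bound (n : ℕ) {η ε : ℝ} (hη : 0 ≤ η) (hε : 0 < ε) :
    ∃ K : ℕ, ∀ b : Fin n → ℤ,
      (∀ h : Fin n → ℤ, h ≠ 0 → (∀ i, |h i| ≤ K) → ∑ i, h i * b i ≠ 0) →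
      volume.real {β : UnitAddCircle | ∀ i, ‖b i • β‖ ≤ η} ≤ (2 * η) ^ n + ε := by
  obtain ⟨δ, hδ0, hδ⟩ : ∃ δ : ℝ, 0 < δ ∧ (2 * η + δ) ^ n ≤ (2 * η) ^ n + ε := by
    have hc : Tendsto (fun δ : ℝ => (2 * η + δ) ^ n) (𝓝[>] 0) (𝓝 ((2 * η + 0) ^ n)) :=
      ((continuous_const.add continuous_id).pow n).continuousAt.tendsto.mono_left
        nhdsWithin_le_nhds
    rw [add_zero] at hc
    have h1 := hc.eventually_le_const (show (2 * η) ^ n < (2 * η) ^ n + ε by linarith)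
    obtain ⟨δ, h2, h3⟩ := (h1.and self_mem_nhdsWithin).exists
    exact ⟨δ, h3, h2⟩
  obtain ⟨c, y, hy0, hy1, hy, c₀, hc₀, hc₀0, hc₀1⟩ := exists_trig_majorant hη hδ0
  -- The bound on the relations is the degree of the majorant, which depends on `n`, `η`, `ε` but
  -- not on `b`.
  refine ⟨c.support.sup Int.natAbs, fun b hb => ?_⟩
  have hyc : Continuous y := by
    have : Continuous fun x : UnitAddCircle => (∑ n ∈ c.support, c n * fourier n x).re := by fun_prop
    convert this using 2 with x
    rw [hy, Complex.ofReal_re]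
  have hyb : Continuous fun β : UnitAddCircle => ∏ i, y (b i • β) := by fun_prop
  have hcl : IsClosed {β : UnitAddCircle | ∀ i, ‖b i • β‖ ≤ η} := by
    simp only [Set.ofPred_forall]
    exact isClosed_iInter fun i => isClosed_le (by fun_prop) continuous_const
  have key : ((∫ β : UnitAddCircle, ∏ i, y (b i • β) : ℝ) : ℂ) = (c₀ : ℂ) ^ n := by
    have e1 : ∀ β : UnitAddCircle, (((∏ i, y (b i • β) : ℝ)) : ℂ) =
        ∑ h ∈ Fintype.piFinset fun _ : Fin n => c.support,
          (∏ i, c (h i)) * fourier (∑ i, h i * b i) β := by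
      intro β
      push_cast
      simp_rw [← hy]
      rw [Finset.prod_univ_sum]
      refine Finset.sum_congr rfl fun h _ => ?_
      rw [Finset.prod_mul_distrib]
      congr 1
      have : ∀ s : Finset (Fin n), ∏ i ∈ s, fourier (h i) (b i • β) =
          fourier (∑ i ∈ s, h i * b i) β := by
        intro s
        induction s using Finset.induction_on with
        | empty => simp
        | insert a s ha ih =>
          rw [Finset.prod_insert ha, Finset.sum_insert ha, fourier_add, ih]
          simp [fourier_apply, mul_smul]
      exact this _
    have e0 : ∫ β : UnitAddCircle, ((((∏ i, y (b i • β) : ℝ)) : ℂ)) =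
        ∑ h ∈ Fintype.piFinset fun _ : Fin n => c.support,
          (∏ i, c (h i)) * (if ∑ i, h i * b i = 0 then 1 else 0) := by
      simp_rw [e1]
      rw [integral_finsetSum]
      · refine Finset.sum_congr rfl fun h _ => ?_
        rw [integral_const_mul, integral_fourier_unitAddCircle]
      · intro h _
        exact (Continuous.integrable_of_hasCompactSupport (by fun_prop)
            (HasCompactSupport.of_compactSpace _))
    refine (integral_ofReal.symm.trans e0).trans ?_
    -- A nonzero frequency vector `h` would survive integration only through a relation `∑ h i * b i
    -- = 0` with entries at most the degree, which is excluded.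
    rw [Finset.sum_eq_single 0]
    · simp [hc₀]
    · intro h hh hne
      rw [if_neg, mul_zero]
      refine hb h hne fun i => ?_
      rw [Int.abs_eq_natAbs]
      exact_mod_cast Finset.le_sup (f := Int.natAbs) (Fintype.mem_piFinset.1 hh i)
    · intro h0
      rw [Fintype.mem_piFinset] at h0
      push Not at h0
      obtain ⟨i, hi⟩ := h0
      rw [Finset.prod_eq_zero (Finset.mem_univ i), zero_mul]
      simpa using hi
  have key' : ∫ β : UnitAddCircle, ∏ i, y (b i • β) = c₀ ^ n := by exact_mod_cast key
  calc volume.real {β : UnitAddCircle | ∀ i, ‖b i • β‖ ≤ η}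
      = ∫ β, {β : UnitAddCircle | ∀ i, ‖b i • β‖ ≤ η}.indicator 1 β :=
        (integral_indicator_one hcl.measurableSet).symm
    _ ≤ ∫ β : UnitAddCircle, ∏ i, y (b i • β) := by
        refine integral_mono ((integrable_indicator_iff hcl.measurableSet).2
          (integrableOn_const (by finiteness)))
          (hyb.integrable_of_hasCompactSupport (HasCompactSupport.of_compactSpace _)) fun β => ?_
        by_cases hβ : β ∈ {β : UnitAddCircle | ∀ i, ‖b i • β‖ ≤ η}
        · rw [Set.indicator_of_mem hβ]
          exact Finset.prod_induction _ (fun x : ℝ => 1 ≤ x) (fun _ _ => one_le_mul_of_one_le_of_one_le)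
            le_rfl fun i _ => hy1 _ (hβ i)
        · rw [Set.indicator_of_notMem hβ]
          exact Finset.prod_nonneg fun i _ => hy0 _
    _ = c₀ ^ n := key'
    _ ≤ (2 * η + δ) ^ n := by gcongr
    _ ≤ _ := hδ

/-! ### Reduction modulo a prime and small values on a box. -/

/-- Descent: independence modulo `p` makes every coefficient of an integer relation divisible by
`p`, and the relation can be divided by `p` and treated again. So each coefficient is divisible by
all powers of `p`. -/
theorem linearIndependent_int_of_zmod {ι κ : Type*} [Fintype ι] {p : ℕ} (hp : p.Prime)
    {f : ι → κ → ℤ} (hf : LinearIndependent (ZMod p) fun i j => (f i j : ZMod p)) :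
    LinearIndependent ℤ f := by
  rw [Fintype.linearIndependent_iff] at hf ⊢
  have key : ∀ n : ℕ, ∀ c : ι → ℤ, ∑ i, c i • f i = 0 → ∀ i, (p : ℤ) ^ n ∣ c i := by
    intro n
    induction n with
    | zero => simp
    | succ n ih =>
      intro c hc
      have h0 : ∀ i, (p : ℤ) ∣ c i := fun i => by
        rw [← ZMod.intCast_zmod_eq_zero_iff_dvd _ p]
        refine hf (fun i => (c i : ZMod p)) ?_ i
        funext j
        have := congrArg (fun z : ℤ => (z : ZMod p)) (congrFun hc j)
        simpa [Finset.sum_apply] using this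
      choose d hd using h0
      have hd' : ∑ i, d i • f i = 0 := by
        have h1 : (p : ℤ) • ∑ i, d i • f i = 0 := by
          rw [Finset.smul_sum, ← hc]
          exact Finset.sum_congr rfl fun i _ => by rw [hd i, smul_smul]
        exact (smul_eq_zero.1 h1).resolve_left (by exact_mod_cast hp.ne_zero)
      intro i
      rw [hd i, pow_succ']
      exact mul_dvd_mul_left _ (ih d hd' i)
  intro c hc i
  apply Int.eq_zero_of_abs_lt_dvd (key (c i).natAbs c hc i)
  rw [Int.abs_eq_natAbs]
  exact_mod_cast Nat.lt_pow_self hp.one_lt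

/-- If the reductions of `S` span a space of dimension above `d` over `ZMod p`, a basis chosen among
them lifts to independent vectors. Otherwise the span has at most `p ^ d` elements and the
pigeonhole principle applies. -/
theorem exists_congr_or_linearIndependent {r p d : ℕ} (hp : p.Prime)
    {S : Finset (Fin r → ℤ)} (hS : p ^ d < S.card) :
    (∃ D ∈ S, ∃ D' ∈ S, D ≠ D' ∧ ∀ i, (p : ℤ) ∣ D i - D' i) ∨
      ∃ f : Fin (d + 1) → Fin r → ℤ, (∀ i, f i ∈ S) ∧ LinearIndependent ℤ f := by
  have : Fact p.Prime := ⟨hp⟩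
  let π : (Fin r → ℤ) → Fin r → ZMod p := fun v i => (v i : ZMod p)
  set W := Submodule.span (ZMod p) (π '' (S : Set (Fin r → ℤ))) with hW
  rcases Nat.lt_or_ge d (Module.finrank (ZMod p) W) with h | h
  · right
    obtain ⟨g, hg, -, hgi⟩ := Submodule.exists_fun_fin_finrank_span_eq (ZMod p)
      (π '' (S : Set (Fin r → ℤ)))
    have h' : d + 1 ≤ Module.finrank (ZMod p)
      (Submodule.span (ZMod p) (π '' (S : Set (Fin r → ℤ)))) := h
    choose f hf hfg using hg
    refine ⟨fun i => f (Fin.castLE h' i), fun i => hf _, linearIndependent_int_of_zmod hp ?_⟩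
    have h2 := hgi.comp (Fin.castLE h') (Fin.castLE_injective h')
    have e : (fun i j => ((f (Fin.castLE h' i) j : ℤ) : ZMod p)) = g ∘ Fin.castLE h' :=
      funext fun i => hfg _
    rw [e]
    exact h2
  · left
    have : Fintype W := Fintype.ofFinite W
    have hcard : Fintype.card W ≤ p ^ d := by
      rw [Module.card_eq_pow_finrank (K := ZMod p), ZMod.card]
      exact Nat.pow_le_pow_right hp.pos h
    have hlt : (Finset.univ : Finset W).card < S.attach.card := by
      rw [Finset.card_univ, Finset.card_attach]
      omega
    obtain ⟨x, -, y, -, hne, hxy⟩ := Finset.exists_ne_map_eq_of_card_lt_of_maps_to hlt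
      (f := fun D => (⟨π D.1, Submodule.subset_span ⟨D.1, D.2, rfl⟩⟩ : W))
      (fun _ _ => Finset.mem_coe.2 (Finset.mem_univ _))
    refine ⟨x.1, x.2, y.1, y.2, fun h => hne (Subtype.ext h), fun i => ?_⟩
    have h1 : π x.1 = π y.1 := congrArg Subtype.val hxy
    have h2 : (x.1 i : ZMod p) = y.1 i := congrFun h1 i
    rw [← ZMod.intCast_zmod_eq_zero_iff_dvd _ p]
    push_cast
    rw [h2, sub_self]

/-- The integer vectors of length `r` with entries in `[-m, m]`. -/
noncomputable def intBox (r m : ℕ) : Finset (Fin r → ℤ) := Fintype.piFinset fun _ => Finset.Icc (-(m : ℤ)) m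

theorem mem_intBox {r m : ℕ} {v : Fin r → ℤ} : v ∈ intBox r m ↔ ∀ i, |v i| ≤ m := by
  simp [intBox, abs_le]

theorem card_intBox (r m : ℕ) : (intBox r m).card = (2 * m + 1) ^ r := by
  simp only [intBox, Fintype.card_piFinset, Int.card_Icc, Finset.prod_const, Finset.card_univ,
    Fintype.card_fin]
  congr 1
  omega

open Classical in
-- Union bound over the two alternatives of the reduction modulo `p` with `d = 4`. Five independent
-- vectors of the box cost `(2 * m + 1) ^ (5 * r)` choices of quasi-independent events. Two
-- congruent vectors differ by `p • v`, where `v` ranges only over a box of side about `m / p`; this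
-- saving of `p ^ r` is the point of a large rank.
theorem volume_many_small_le {r p m K : ℕ} (hp : p.Prime) (φ : (Fin r → ℤ) →+ ℤ) {η ε : ℝ}
    (hη : 0 ≤ η) (hε : 0 ≤ ε)
    (hK : ∀ b : Fin 5 → ℤ,
      (∀ h : Fin 5 → ℤ, h ≠ 0 → (∀ i, |h i| ≤ K) → ∑ i, h i * b i ≠ 0) →
      volume.real {β : UnitAddCircle | ∀ i, ‖b i • β‖ ≤ η} ≤ (2 * η) ^ 5 + ε)
    (hφ : ∀ v : Fin r → ℤ, v ≠ 0 → (∀ i, |v i| ≤ (2 + 5 * K) * m) → φ v ≠ 0) :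
    volume.real {β : UnitAddCircle |
        p ^ 4 < ((intBox r m).filter fun D => D ≠ 0 ∧ ‖φ D • β‖ ≤ η).card} ≤
      ((2 * m + 1 : ℕ) : ℝ) ^ (5 * r) * ((2 * η) ^ 5 + ε) +
        ((2 * (2 * m / p) + 1 : ℕ) : ℝ) ^ r * (4 * η) := by
  set F := (Fintype.piFinset fun _ : Fin 5 => intBox r m).filter fun f => LinearIndependent ℤ f
  set V := (intBox r (2 * m / p)).filter fun v => v ≠ 0
  have hsub : {β : UnitAddCircle |
        p ^ 4 < ((intBox r m).filter fun D => D ≠ 0 ∧ ‖φ D • β‖ ≤ η).card} ⊆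
      (⋃ f ∈ F, {β : UnitAddCircle | ∀ i, ‖φ (f i) • β‖ ≤ η}) ∪
        ⋃ v ∈ V, {β : UnitAddCircle | ‖φ ((p : ℤ) • v) • β‖ ≤ 2 * η} := by
    intro β hβ
    rcases exists_congr_or_linearIndependent hp hβ with ⟨D, hD, D', hD', hne, hdvd⟩ | ⟨f, hf, hi⟩
    · right
      rw [Finset.mem_filter, mem_intBox] at hD hD'
      choose v hv using hdvd
      have hv' : D - D' = (p : ℤ) • v := by
        funext i; simpa using hv i
      have hv0 : v ≠ 0 := by
        rintro rfl
        exact hne (sub_eq_zero.1 (by simpa using hv'))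
      rw [Set.mem_iUnion₂]
      refine ⟨v, ?_, ?_⟩
      · rw [Finset.mem_filter, mem_intBox]
        refine ⟨fun i => ?_, hv0⟩
        have h1 : |D i - D' i| ≤ 2 * m := (abs_sub _ _).trans (by linarith [hD.1 i, hD'.1 i])
        rw [hv i, abs_mul, Nat.abs_cast] at h1
        push_cast
        rw [Int.le_ediv_iff_mul_le (by exact_mod_cast hp.pos)]
        linarith
      · rw [Set.mem_ofPred_eq, ← hv', map_sub, sub_smul]
        exact (norm_sub_le _ _).trans (by linarith [hD.2.2, hD'.2.2])
    · left
      rw [Set.mem_iUnion₂]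
      refine ⟨f, ?_, fun i => (Finset.mem_filter.1 (hf i)).2.2⟩
      rw [Finset.mem_filter, Fintype.mem_piFinset]
      exact ⟨fun i => (Finset.mem_filter.1 (hf i)).1, hi⟩
  refine (measureReal_mono hsub).trans ((measureReal_union_le _ _).trans (add_le_add ?_ ?_))
  · refine (measureReal_biUnion_finset_le _ _).trans ((Finset.sum_le_card_nsmul _ _
      ((2 * η) ^ 5 + ε) fun f hf => ?_).trans ?_)
    · rw [Finset.mem_filter, Fintype.mem_piFinset] at hf
      refine hK _ fun h h0 hh => ?_
      have e : ∑ i, h i * φ (f i) = φ (∑ i, h i • f i) := by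
        rw [map_sum]
        exact Finset.sum_congr rfl fun i _ => by rw [map_zsmul, smul_eq_mul]
      rw [e]
      refine hφ _ (fun hs => h0 ?_) fun j => ?_
      · funext i
        exact Fintype.linearIndependent_iff.1 hf.2 h hs i
      · rw [Finset.sum_apply]
        -- Five vectors with entries at most `m` and coefficients at most `K` give entries at most
        -- `5 * K * m`; the extra `2 * m` in `hφ` covers the vectors `v` of the other alternative.
        refine (Finset.abs_sum_le_sum_abs _ _).trans ((Finset.sum_le_card_nsmul _ _
          ((K : ℤ) * m) fun i _ => ?_).trans ?_)
        · rw [Pi.smul_apply, smul_eq_mul, abs_mul]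
          exact mul_le_mul (hh i) (mem_intBox.1 (hf.1 i) j) (abs_nonneg _) (by positivity)
        · simp only [Finset.card_univ, Fintype.card_fin, nsmul_eq_mul]
          push_cast
          nlinarith [Int.natCast_nonneg m]
    · rw [nsmul_eq_mul]
      refine mul_le_mul_of_nonneg_right ?_ (by positivity)
      have h1 : F.card ≤ (2 * m + 1) ^ (5 * r) := by
        refine (Finset.card_filter_le _ _).trans ?_
        rw [Fintype.card_piFinset, Finset.prod_const, card_intBox, Finset.card_univ,
          Fintype.card_fin, ← pow_mul, mul_comm r 5]
      exact_mod_cast h1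
  · refine (measureReal_biUnion_finset_le _ _).trans ((Finset.sum_le_card_nsmul _ _
      (4 * η) fun v hv => ?_).trans ?_)
    · rw [Finset.mem_filter, mem_intBox] at hv
      have hne : φ ((p : ℤ) • v) ≠ 0 := by
        rw [map_zsmul, smul_eq_mul]
        refine mul_ne_zero (by exact_mod_cast hp.ne_zero) (hφ v hv.2 fun i => (hv.1 i).trans ?_)
        have : 2 * m / p ≤ 2 * m := Nat.div_le_self _ _
        have : ((2 * m / p : ℕ) : ℤ) ≤ 2 * m := by exact_mod_cast this
        have : 0 ≤ 5 * (K : ℤ) * m := by positivity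
        linarith
      rw [volume_zsmul_norm_le hne (by positivity)]
      exact (min_le_right _ _).trans (by linarith)
    · rw [nsmul_eq_mul]
      refine mul_le_mul_of_nonneg_right ?_ (by positivity)
      have h1 : V.card ≤ (2 * (2 * m / p) + 1) ^ r :=
        (Finset.card_filter_le _ _).trans (card_intBox _ _).le
      exact_mod_cast h1

/-! ### Rapidly growing weights -/

/-- `C` is left free so that it can encode every bound on coefficients that the later arguments
require. -/
theorem exists_rapid (C : ℕ → ℕ) :
    ∃ Q : ℕ → ℕ, ∀ i, C i * ∑ j ∈ Finset.range i, Q j < Q i := by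
  let S : ℕ → ℕ := fun n => Nat.rec 0 (fun i s => s + (C i * s + 1)) n
  refine ⟨fun i => C i * S i + 1, fun i => ?_⟩
  have h : ∀ n, ∑ j ∈ Finset.range n, (C j * S j + 1) = S n := by
    intro n
    induction n with
    | zero => rfl
    | succ n ih => rw [Finset.sum_range_succ, ih]
  rw [h]
  exact Nat.lt_succ_self _

/-- The homomorphism from the free abelian group on `ℕ` sending the `i`-th generator to `Q i`. -/
noncomputable def weigh (Q : ℕ → ℕ) : (ℕ →₀ ℤ) →ₗ[ℤ] ℤ :=
  Finsupp.linearCombination ℤ fun i => (Q i : ℤ)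

theorem weigh_single (Q : ℕ → ℕ) (i : ℕ) (x : ℤ) : weigh Q (Finsupp.single i x) = x * Q i := by
  simp [weigh]

theorem weigh_apply (Q : ℕ → ℕ) (w : ℕ →₀ ℤ) : weigh Q w = ∑ i ∈ w.support, w i * Q i := by
  simp [weigh, Finsupp.linearCombination_apply, Finsupp.sum]

theorem abs_weigh_lt {C Q : ℕ → ℕ} (hQ : ∀ i, C i * ∑ j ∈ Finset.range i, Q j < Q i)
    {w : ℕ →₀ ℤ} {i : ℕ} (hs : ∀ j, w j ≠ 0 → j < i) (hw : ∀ j, |w j| ≤ C i) :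
    |weigh Q w| < Q i := by
  rw [weigh_apply]
  refine ((Finset.abs_sum_le_sum_abs _ _).trans ?_).trans_lt
    (show ((C i * ∑ j ∈ Finset.range i, Q j : ℕ) : ℤ) < Q i by exact_mod_cast hQ i)
  push_cast
  rw [Finset.mul_sum]
  refine (Finset.sum_le_sum_of_subset_of_nonneg (t := Finset.range i) (fun j hj => ?_)
    fun _ _ _ => abs_nonneg _).trans (Finset.sum_le_sum fun j _ => ?_)
  · exact Finset.mem_range.2 (hs j (Finsupp.mem_support_iff.1 hj))
  · rw [abs_mul, Nat.abs_cast]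
    exact mul_le_mul_of_nonneg_right (hw j) (by positivity)

/-- At the largest index `i` of the support the term is at least `Q i` in absolute value, and all
lower terms together stay below `Q i`. -/
theorem weigh_ne_zero {C Q : ℕ → ℕ} (hQ : ∀ i, C i * ∑ j ∈ Finset.range i, Q j < Q i)
    {w : ℕ →₀ ℤ} (hw0 : w ≠ 0) (hw : ∀ i, w i ≠ 0 → ∀ j, j ≤ i → |w j| ≤ C i) :
    weigh Q w ≠ 0 := by
  have hne : w.support.Nonempty := Finsupp.support_nonempty_iff.2 hw0
  set i := w.support.max' hne
  have hi : w i ≠ 0 := Finsupp.mem_support_iff.1 (Finset.max'_mem _ hne)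
  have htop : ∀ j, w j ≠ 0 → j ≤ i := fun j hj =>
    Finset.le_max' _ _ (Finsupp.mem_support_iff.2 hj)
  have hdec : w = Finsupp.single i (w i) + w.erase i := (Finsupp.single_add_erase i w).symm
  have hlt : |weigh Q (w.erase i)| < Q i := by
    refine abs_weigh_lt hQ (fun j hj => ?_) fun j => ?_
    · rcases eq_or_ne j i with rfl | hji
      · simp at hj
      · rw [Finsupp.erase_ne hji] at hj
        exact lt_of_le_of_ne (htop j hj) hji
    · rcases eq_or_ne j i with rfl | hji
      · simp
      · rw [Finsupp.erase_ne hji]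
        by_cases hj : w j = 0
        · simp [hj]
        · exact hw i hi j (htop j hj)
  intro h0
  rw [hdec, map_add, weigh_single] at h0
  have h1 : |w i * Q i| < Q i := by
    rw [eq_neg_of_add_eq_zero_left h0, abs_neg]
    exact hlt
  rw [abs_mul, Nat.abs_cast] at h1
  nlinarith [Int.one_le_abs hi, Int.natCast_nonneg (Q i)]

/-! ### Vectors with labels -/

/-- Evaluation at label coordinates sees only which labels coincide, which turns vector relations
into counting of labels. -/
theorem apply_label {u : ℕ → ℕ →₀ ℤ} {lab : ℕ → ℕ} (hu1 : ∀ n, u n (lab n) = 1)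
    (hu2 : ∀ n c, u n c ≠ 0 → lab c = lab n) (n x : ℕ) :
    u n (lab x) = if lab x = lab n then 1 else 0 := by
  split_ifs with h
  · rw [h, hu1]
  · by_contra hne
    refine h ?_
    rw [← hu2 n _ hne]
    exact (hu2 x _ (by rw [hu1]; exact one_ne_zero)).symm

/-- Vectors with different labels have disjoint supports, so the identity separates into its two
label classes. -/
theorem eq_of_sub_eq_sub {u : ℕ → ℕ →₀ ℤ} {lab : ℕ → ℕ} (hu2 : ∀ n c, u n c ≠ 0 → lab c = lab n)
    {i j l p : ℕ} (hij : lab i ≠ lab j) (hil : lab i = lab l) (hjp : lab j = lab p)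
    (h : u i + u p = u l + u j) : u i = u l ∧ u j = u p := by
  have h0 : ∀ n c, lab c ≠ lab n → u n c = 0 := fun n c hc => by
    by_contra hne
    exact hc (hu2 n c hne)
  have hc : ∀ c, u i c + u p c = u l c + u j c := fun c => by
    simpa using DFunLike.congr_fun h c
  refine ⟨Finsupp.ext fun c => ?_, Finsupp.ext fun c => ?_⟩
  · by_cases hci : lab c = lab i
    · have := hc c
      rwa [h0 p c (by rw [hci, ← hjp]; exact hij), h0 j c (by rwa [hci]), add_zero, add_zero] at this
    · rw [h0 i c hci, h0 l c (by rwa [← hil])]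
  · by_cases hcj : lab c = lab j
    · have := hc c
      rw [h0 i c (by rw [hcj]; exact hij.symm), h0 l c (by rw [hcj, ← hil]; exact hij.symm),
        zero_add, zero_add] at this
      exact this.symm
    · rw [h0 j c hcj, h0 p c (by rwa [← hjp])]

/-- This is the pairwise independence behind the variance bound. Evaluating at the four label
coordinates forces `a = b = 0` unless the two label pairs agree up to order. In that case `b = -a`
or `b = a`, and separating the supports together with injectivity contradicts `h1` or `h2`. -/
theorem sub_independent {u : ℕ → ℕ →₀ ℤ} {lab : ℕ → ℕ} (hu1 : ∀ n, u n (lab n) = 1)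
    (hu2 : ∀ n c, u n c ≠ 0 → lab c = lab n) (hinj : Function.Injective u)
    {i j l p : ℕ} (hij : lab i ≠ lab j) (hlp : lab l ≠ lab p)
    (h1 : ¬(i = l ∧ j = p)) (h2 : ¬(i = p ∧ j = l)) {a b : ℤ}
    (h : a • (u i - u j) + b • (u l - u p) = 0) : a = 0 ∧ b = 0 := by
  have hx : ∀ x, a * ((if lab x = lab i then 1 else 0) - (if lab x = lab j then 1 else 0)) +
      b * ((if lab x = lab l then 1 else 0) - (if lab x = lab p then 1 else 0)) = 0 := fun x => by
    have := DFunLike.congr_fun h (lab x)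
    simpa only [Finsupp.add_apply, Finsupp.smul_apply, Finsupp.sub_apply, smul_eq_mul,
      apply_label hu1 hu2, Finsupp.zero_apply] using this
  have hi := hx i
  have hj := hx j
  have hl := hx l
  have hp := hx p
  by_cases e1 : lab i = lab l
  · by_cases e2 : lab j = lab p
    · have hab : b = -a := by
        simp only [if_true, if_neg hij, if_pos e1, if_neg (fun h => hlp (e1.symm.trans h) :
          lab i ≠ lab p)] at hi
        linarith
      rcases eq_or_ne a 0 with ha | ha
      · simp [hab, ha]
      · exfalso
        rw [hab, neg_smul, ← sub_eq_add_neg, ← smul_sub] at h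
        have h3 := (smul_eq_zero.1 h).resolve_left ha
        have h4 : u i + u p = u l + u j := by
          rw [← sub_eq_zero, ← h3]; abel
        obtain ⟨h5, h6⟩ := eq_of_sub_eq_sub hu2 hij e1 e2 h4
        exact h1 ⟨hinj h5, hinj h6⟩
    · simp only [if_true, if_neg e2, if_neg hij.symm, if_neg (fun h => hij (e1.trans h.symm) :
        lab j ≠ lab l)] at hj
      simp only [if_true, if_neg hij, if_pos e1, if_neg (fun h => hlp (e1.symm.trans h) :
          lab i ≠ lab p)] at hi
      constructor <;> linarith
  · by_cases e2 : lab i = lab p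
    · by_cases e3 : lab j = lab l
      · have hab : b = a := by
          simp only [if_true, if_neg hij, if_neg e1, if_pos e2] at hi
          linarith
        rcases eq_or_ne a 0 with ha | ha
        · simp [hab, ha]
        · exfalso
          rw [hab, ← smul_add] at h
          have h3 := (smul_eq_zero.1 h).resolve_left ha
          have h4 : u i + u l = u p + u j := by
            rw [← sub_eq_zero, ← h3]; abel
          obtain ⟨h5, h6⟩ := eq_of_sub_eq_sub hu2 hij e2 e3 h4
          exact h2 ⟨hinj h5, hinj h6⟩
      · simp only [if_true, if_neg e3, if_neg hij.symm, if_neg (fun h => hij (e2.trans h.symm) :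
          lab j ≠ lab p)] at hj
        simp only [if_true, if_neg hij, if_neg e1, if_pos e2] at hi
        constructor <;> linarith
    · simp only [if_true, if_neg hij, if_neg e1, if_neg e2] at hi
      have ha : a = 0 := by linarith
      simp only [if_true, if_neg hlp, ha] at hl
      exact ⟨ha, by linarith⟩

/-- Only additive quadruples within a single label class can be nontrivial, so the energy beyond the
diagonal comes from the progressions alone. -/
theorem add_eq_add_cases {u : ℕ → ℕ →₀ ℤ} {lab : ℕ → ℕ} (hu1 : ∀ n, u n (lab n) = 1)
    (hu2 : ∀ n c, u n c ≠ 0 → lab c = lab n) (hinj : Function.Injective u)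
    {i j l p : ℕ} (h : u i + u j = u l + u p) :
    (i = l ∧ j = p) ∨ (i = p ∧ j = l) ∨ (lab j = lab i ∧ lab l = lab i ∧ lab p = lab i) := by
  have hx : ∀ x, ((if lab x = lab i then 1 else 0) + (if lab x = lab j then 1 else 0) : ℤ) =
      ((if lab x = lab l then 1 else 0) + (if lab x = lab p then 1 else 0)) := fun x => by
    have := DFunLike.congr_fun h (lab x)
    simpa only [Finsupp.add_apply, apply_label hu1 hu2] using this
  have hi := hx i
  have hj := hx j
  by_cases hij : lab i = lab j
  · right; right
    simp only [hij, if_true] at hi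
    refine ⟨hij.symm, ?_, ?_⟩
    · by_contra hne
      rw [if_neg (fun h => hne (h.symm.trans hij.symm))] at hi
      split_ifs at hi <;> omega
    · by_contra hne
      rw [if_neg (c := lab j = lab p) (fun h => hne (h.symm.trans hij.symm))] at hi
      split_ifs at hi <;> omega
  · by_cases hil : lab i = lab l
    · left
      have hjp : lab j = lab p := by
        by_contra hne
        simp only [if_true, if_neg (Ne.symm hij), if_neg hne,
          if_neg (fun h => hij (hil.trans h.symm) : lab j ≠ lab l)] at hj
        omega
      obtain ⟨h5, h6⟩ := eq_of_sub_eq_sub (i := i) (p := j) (l := l) (j := p) hu2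
        (by rwa [← hjp]) hil hjp.symm h
      exact ⟨hinj h5, (hinj h6).symm⟩
    · right; left
      have hip : lab i = lab p := by
        by_contra hne
        simp only [if_true, if_neg hij, if_neg hne, if_neg hil] at hi
        omega
      have hjl : lab j = lab l := by
        by_contra hne
        simp only [if_true, if_neg (Ne.symm hij), if_neg hne,
          if_neg (fun h => hij (hip.trans h.symm) : lab j ≠ lab p)] at hj
        omega
      obtain ⟨h5, h6⟩ := eq_of_sub_eq_sub (i := i) (p := j) (l := p) (j := l) hu2
        (by rwa [← hjl]) hip hjl.symm (by rw [h, add_comm])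
      exact ⟨hinj h5, (hinj h6).symm⟩

/-! ### The blocks -/

/-- The index of the dyadic block containing `n`, namely the `k` with `2 ^ k ≤ n + 1 < 2 ^ (k + 1)`. -/
def blk (n : ℕ) : ℕ := Nat.log 2 (n + 1)

/-- The position of `n` in its dyadic block. -/
def pos (n : ℕ) : ℕ := n + 1 - 2 ^ blk n

theorem two_pow_blk_le (n : ℕ) : 2 ^ blk n ≤ n + 1 := Nat.pow_log_le_self 2 (by omega)

theorem lt_two_pow_blk (n : ℕ) : n + 1 < 2 ^ (blk n + 1) := Nat.lt_pow_succ_log_self (by omega) _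

theorem pos_spec (n : ℕ) : n + 1 = 2 ^ blk n + pos n := by
  have := two_pow_blk_le n
  unfold pos; omega

theorem blk_eq {n k i : ℕ} (h : n + 1 = 2 ^ k + i) (hi : i < 2 ^ k) : blk n = k := by
  apply Nat.log_eq_of_pow_le_of_lt_pow
  · omega
  · rw [pow_succ]; omega

theorem pos_eq {n k i : ℕ} (h : n + 1 = 2 ^ k + i) (hi : i < 2 ^ k) : pos n = i := by
  rw [pos, blk_eq h hi]; omega

/-- The label of `n`: the first index of its block if `n` is among the first `m ^ r` members of the
block, where `m` depends on the block, and `n` itself otherwise. -/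
def lab (r : ℕ) (m : ℕ → ℕ) (n : ℕ) : ℕ := if pos n < m (blk n) ^ r then 2 ^ blk n - 1 else n

/-- The first `m ^ r` members of a block form a generalized arithmetic progression of rank `r`, the
other ones are independent. -/
noncomputable def vec (r : ℕ) (m : ℕ → ℕ) (n : ℕ) : ℕ →₀ ℤ :=
  if pos n < m (blk n) ^ r then
    Finsupp.single (2 ^ blk n - 1) 1 + ∑ i ∈ Finset.range r,
      Finsupp.single (2 ^ blk n + i) ((pos n / m (blk n) ^ i % m (blk n) : ℕ) : ℤ)
  else Finsupp.single n 1

section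

variable {r : ℕ} {m : ℕ → ℕ}

theorem vec_of_not (n : ℕ) (h : ¬ pos n < m (blk n) ^ r) : vec r m n = Finsupp.single n 1 :=
  if_neg h

theorem lab_of_not (n : ℕ) (h : ¬ pos n < m (blk n) ^ r) : lab r m n = n := if_neg h

theorem lab_of_lt (n : ℕ) (h : pos n < m (blk n) ^ r) : lab r m n = 2 ^ blk n - 1 := if_pos h

theorem vec_base (n : ℕ) (h : pos n < m (blk n) ^ r) : vec r m n (2 ^ blk n - 1) = 1 := by
  have : 0 < 2 ^ blk n := by positivity
  rw [vec, if_pos h, Finsupp.add_apply, Finsupp.single_eq_same, Finsupp.finsetSum_apply,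
    Finset.sum_eq_zero, add_zero]
  intro i _
  rw [Finsupp.single_eq_of_ne (by omega)]

theorem vec_digit (n i : ℕ) (h : pos n < m (blk n) ^ r) (hi : i < r) :
    vec r m n (2 ^ blk n + i) = ((pos n / m (blk n) ^ i % m (blk n) : ℕ) : ℤ) := by
  have : 0 < 2 ^ blk n := by positivity
  rw [vec, if_pos h, Finsupp.add_apply, Finsupp.single_eq_of_ne (by omega),
    Finsupp.finsetSum_apply, Finset.sum_eq_single i, zero_add, Finsupp.single_eq_same]
  · intro j _ hj
    rw [Finsupp.single_eq_of_ne (by omega)]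
  · intro h; exact absurd (Finset.mem_range.2 hi) h

theorem vec_cases (n c : ℕ) (h : pos n < m (blk n) ^ r) :
    c = 2 ^ blk n - 1 ∨ (∃ i < r, c = 2 ^ blk n + i) ∨ vec r m n c = 0 := by
  by_cases h1 : c = 2 ^ blk n - 1
  · exact Or.inl h1
  by_cases h2 : ∃ i < r, c = 2 ^ blk n + i
  · exact Or.inr (Or.inl h2)
  refine Or.inr (Or.inr ?_)
  rw [vec, if_pos h, Finsupp.add_apply, Finsupp.single_eq_of_ne (by omega),
    Finsupp.finsetSum_apply, Finset.sum_eq_zero, zero_add]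
  intro j hj
  rw [Finsupp.single_eq_of_ne]
  rintro rfl
  exact h2 ⟨j, Finset.mem_range.1 hj, rfl⟩

theorem vec_label (n : ℕ) : vec r m n (lab r m n) = 1 := by
  by_cases h : pos n < m (blk n) ^ r
  · rw [lab_of_lt n h, vec_base n h]
  · rw [lab_of_not n h, vec_of_not n h, Finsupp.single_eq_same]

theorem lab_start (k : ℕ) : lab r m (2 ^ k - 1) = 2 ^ k - 1 := by
  have : 0 < 2 ^ k := by positivity
  have e : 2 ^ k - 1 + 1 = 2 ^ k + 0 := by omega
  rw [lab, blk_eq e this]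
  simp

/-- Vectors of late indices involve only late coordinates, where the weights can be adapted to the
range of indices under study. -/
theorem index_le_of_vec_ne_zero (n c : ℕ) (hc : vec r m n c ≠ 0) :
    2 ^ blk n ≤ c + 1 ∧ n ≤ 2 * c + 1 := by
  have h3 := lt_two_pow_blk n
  have h4 := two_pow_blk_le n
  rw [pow_succ] at h3
  by_cases h : pos n < m (blk n) ^ r
  · rcases vec_cases n c h with h | ⟨i, hi, h⟩ | h0
    · omega
    · omega
    · exact absurd h0 hc
  · rw [vec_of_not n h] at hc
    have : c = n := by
      by_contra hne
      exact hc (Finsupp.single_eq_of_ne hne)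
    omega

variable (hm1 : ∀ k, 1 ≤ m k)
include hm1

variable (hmr : ∀ k, m k ^ r ≤ 2 ^ k)
include hmr

/-- The coordinate `2 ^ blk n + i` sits at position `i + 1` of its block. A nonzero digit forces `m
≥ 2`, and then `i + 1 ≤ r < 2 ^ r ≤ m ^ r` keeps that position inside the progression. -/
theorem vec_lab_eq (n c : ℕ) (hc : vec r m n c ≠ 0) : lab r m c = lab r m n := by
  by_cases h : pos n < m (blk n) ^ r
  · rw [lab_of_lt n h]
    rcases vec_cases n c h with rfl | ⟨i, hi, rfl⟩ | h0
    · exact lab_start _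
    · rw [vec_digit n i h hi] at hc
      have hm2 : 2 ≤ m (blk n) := by
        by_contra hlt
        have : m (blk n) = 1 := by have := hm1 (blk n); omega
        rw [this, Nat.mod_one] at hc
        simp at hc
      have h1 : i + 1 < m (blk n) ^ r := by
        calc i + 1 ≤ r := hi
          _ < 2 ^ r := Nat.lt_two_pow_self
          _ ≤ m (blk n) ^ r := Nat.pow_le_pow_left hm2 r
      have h2 := h1.trans_le (hmr (blk n))
      have e : 2 ^ blk n + i + 1 = 2 ^ blk n + (i + 1) := by ring
      rw [lab, blk_eq e h2, pos_eq e h2, if_pos h1]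
    · exact absurd h0 hc
  · rw [vec_of_not n h] at hc
    have : c = n := by
      by_contra hne
      exact hc (Finsupp.single_eq_of_ne hne)
    rw [this]

variable (hr : 1 ≤ r)
include hr

/-- The bound by `c + 1` depends only on the coordinate and serves the energy and the monotonicity;
the bound by `2 ^ blk n` depends only on the index and serves the late pairs. -/
theorem vec_nonneg_le (n c : ℕ) : 0 ≤ vec r m n c ∧ vec r m n c ≤ c + 1 ∧
    vec r m n c ≤ 2 ^ blk n := by
  have hp : (1 : ℤ) ≤ 2 ^ blk n := by exact_mod_cast Nat.one_le_two_pow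
  by_cases h : pos n < m (blk n) ^ r
  · rcases vec_cases n c h with h0 | ⟨i, hi, h0⟩ | h0
    · rw [h0, vec_base n h]
      exact ⟨by norm_num, by linarith [Int.natCast_nonneg (2 ^ blk n - 1)], hp⟩
    · rw [h0, vec_digit n i h hi]
      have h1 : pos n / m (blk n) ^ i % m (blk n) < m (blk n) := Nat.mod_lt _ (hm1 _)
      have h2 : m (blk n) ≤ 2 ^ blk n :=
        (Nat.le_self_pow (by omega) _).trans (hmr _)
      refine ⟨by positivity, ?_, ?_⟩
      · exact_mod_cast (by omega : pos n / m (blk n) ^ i % m (blk n) ≤ 2 ^ blk n + i + 1)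
      · exact_mod_cast (by omega : pos n / m (blk n) ^ i % m (blk n) ≤ 2 ^ blk n)
    · rw [h0]; exact ⟨le_rfl, by positivity, by positivity⟩
  · rw [vec_of_not n h]
    rcases eq_or_ne c n with rfl | hne
    · rw [Finsupp.single_eq_same]
      exact ⟨by norm_num, by linarith [Int.natCast_nonneg c], hp⟩
    · rw [Finsupp.single_eq_of_ne hne]; exact ⟨le_rfl, by positivity, by positivity⟩

end

/-! ### Monotonicity and positivity of the sequence. -/

/-- Each weight exceeds `m` times the sum of the earlier ones, so the leading differing digit
decides the order. -/
theorem digit_sum_lt {m : ℕ} (hm : 1 ≤ m) {q : ℕ → ℤ} (hq0 : ∀ i, 0 ≤ q i)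
    (hq : ∀ i, (m : ℤ) * ∑ j ∈ Finset.range i, q j < q i) (r : ℕ) {l l' : ℕ} (hl : l < l')
    (hl' : l' < m ^ r) :
    ∑ i ∈ Finset.range r, ((l / m ^ i % m : ℕ) : ℤ) * q i <
      ∑ i ∈ Finset.range r, ((l' / m ^ i % m : ℕ) : ℤ) * q i := by
  induction r generalizing l l' with
  | zero => simp at hl'; omega
  | succ r ih =>
    have hmr : 0 < m ^ r := by positivity
    have hlow : ∀ l : ℕ, ∑ i ∈ Finset.range r, ((l / m ^ i % m : ℕ) : ℤ) * q i =
        ∑ i ∈ Finset.range r, ((l % m ^ r / m ^ i % m : ℕ) : ℤ) * q i := by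
      intro l
      refine Finset.sum_congr rfl fun i hi => ?_
      have hi' := Finset.mem_range.1 hi
      have e : m ^ r = m ^ i * m ^ (r - i) := by rw [← pow_add]; congr 1; omega
      rw [e, Nat.mod_mul_right_div_self, Nat.mod_mod_of_dvd _ (dvd_pow_self m (by omega))]
    have hdig : ∀ l < m ^ (r + 1), l / m ^ r % m = l / m ^ r := fun l hl =>
      Nat.mod_eq_of_lt (Nat.div_lt_of_lt_mul (by rwa [← pow_succ]))
    rw [Finset.sum_range_succ, Finset.sum_range_succ, hdig l (hl.trans hl'), hdig l' hl',
      hlow l, hlow l']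
    have hle : l / m ^ r ≤ l' / m ^ r := Nat.div_le_div_right hl.le
    rcases hle.eq_or_lt with h | h
    · rw [h]
      have h1 := Nat.div_add_mod l (m ^ r)
      have h2 := Nat.div_add_mod l' (m ^ r)
      rw [h] at h1
      have := ih (show l % m ^ r < l' % m ^ r by omega) (Nat.mod_lt _ hmr)
      linarith
    · have h1 : ∑ i ∈ Finset.range r, ((l % m ^ r / m ^ i % m : ℕ) : ℤ) * q i ≤
          m * ∑ i ∈ Finset.range r, q i := by
        rw [Finset.mul_sum]
        refine Finset.sum_le_sum fun i _ => mul_le_mul_of_nonneg_right ?_ (hq0 i)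
        exact_mod_cast (Nat.mod_lt _ (by omega)).le
      have h2 : 0 ≤ ∑ i ∈ Finset.range r, ((l' % m ^ r / m ^ i % m : ℕ) : ℤ) * q i :=
        Finset.sum_nonneg fun i _ => mul_nonneg (by positivity) (hq0 i)
      have h3 : ((l / m ^ r : ℕ) : ℤ) + 1 ≤ (l' / m ^ r : ℕ) := by exact_mod_cast h
      nlinarith [hq r, hq0 r]

section

variable {r : ℕ} {m : ℕ → ℕ} (hm1 : ∀ k, 1 ≤ m k) (hmr : ∀ k, m k ^ r ≤ 2 ^ k)
  (hr : 1 ≤ r) {C Q : ℕ → ℕ} (hC : ∀ i, 4 * (i + 1) ≤ C i)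
  (hQ : ∀ i, C i * ∑ j ∈ Finset.range i, Q j < Q i)

theorem weigh_vec_of_lt (Q : ℕ → ℕ) (n : ℕ) (h : pos n < m (blk n) ^ r) :
    weigh Q (vec r m n) = Q (2 ^ blk n - 1) + ∑ i ∈ Finset.range r,
      ((pos n / m (blk n) ^ i % m (blk n) : ℕ) : ℤ) * Q (2 ^ blk n + i) := by
  rw [vec, if_pos h, map_add, map_sum, weigh_single, one_mul]
  simp_rw [weigh_single]

include hm1 hmr hr hC hQ

/-- If `n + 1` is its own label, it brings in the new weight `Q (n + 1)`, which dominates everything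
available to `n`. Otherwise `n` and `n + 1` are consecutive in one progression and their digit
expansions are compared. -/
theorem weigh_vec_lt_succ (n : ℕ) : weigh Q (vec r m n) < weigh Q (vec r m (n + 1)) := by
  by_cases hA : lab r m (n + 1) = n + 1
  · have h1 : (Q (n + 1) : ℤ) ≤ weigh Q (vec r m (n + 1)) := by
      rw [weigh_apply]
      have h2 : vec r m (n + 1) (n + 1) = 1 := by
        have := vec_label (r := r) (m := m) (n + 1); rwa [hA] at this
      refine le_trans ?_ (Finset.single_le_sum (f := fun i => vec r m (n + 1) i * (Q i : ℤ))
        (fun i _ => mul_nonneg (vec_nonneg_le hm1 hmr hr _ i).1 (by positivity))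
        (Finsupp.mem_support_iff.2 (show vec r m (n + 1) (n + 1) ≠ 0 by rw [h2]; exact one_ne_zero)))
      simp [h2]
    have hs : ∀ c, vec r m n c ≠ 0 → c < n + 1 := by
      intro c hc
      by_contra hcn
      have hl := vec_lab_eq hm1 hmr n c hc
      by_cases h : pos n < m (blk n) ^ r
      · rw [lab_of_lt n h] at hl
        have h4 := two_pow_blk_le n
        have h5 : pos c < m (blk c) ^ r := by
          by_contra h6
          rw [lab_of_not c h6] at hl
          omega
        rw [lab_of_lt c h5] at hl
        have h6 : blk c = blk n := by
          have h7 : 0 < 2 ^ blk c := by positivity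
          have h8 : 0 < 2 ^ blk n := by positivity
          exact Nat.pow_right_injective le_rfl (show 2 ^ blk c = 2 ^ blk n by omega)
        have h7 := pos_spec c
        have h8 := pos_spec n
        rw [h6] at h7 h5
        have h9 : pos n + 1 < 2 ^ blk n := by have := hmr (blk n); omega
        have e : n + 1 + 1 = 2 ^ blk n + (pos n + 1) := by omega
        rw [lab, blk_eq e h9, pos_eq e h9, if_pos (by omega)] at hA
        omega
      · rw [vec_of_not n h] at hc
        exact hc (Finsupp.single_eq_of_ne (by omega))
    have h3 : |weigh Q (vec r m n)| < Q (n + 1) := by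
      refine abs_weigh_lt hQ hs fun j => ?_
      obtain ⟨h0, h1, -⟩ := vec_nonneg_le hm1 hmr hr n j
      rw [abs_of_nonneg h0]
      by_cases hj : vec r m n j = 0
      · rw [hj]; positivity
      · have := hs j hj
        have := hC (n + 1)
        have : ((j + 1 : ℕ) : ℤ) ≤ C (n + 1) := by exact_mod_cast (by omega)
        push_cast at this
        linarith
    exact ((le_abs_self _).trans_lt h3).trans_le h1
  · have hG : pos (n + 1) < m (blk (n + 1)) ^ r := by
      by_contra h
      exact hA (lab_of_not _ h)
    have h1 := pos_spec (n + 1)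
    rw [lab_of_lt _ hG] at hA
    have h2 := (hmr (blk (n + 1)))
    have e : n + 1 = 2 ^ blk (n + 1) + (pos (n + 1) - 1) := by omega
    have h3 : pos (n + 1) - 1 < 2 ^ blk (n + 1) := by omega
    have hb := blk_eq e h3
    have hp := pos_eq e h3
    have hG' : pos n < m (blk n) ^ r := by rw [hb, hp]; omega
    rw [weigh_vec_of_lt Q n hG', weigh_vec_of_lt Q _ hG, hb]
    refine add_lt_add_right ?_ _
    refine digit_sum_lt (hm1 _) (fun i => by positivity) (fun i => ?_) r (by omega) hG
    have h4 : m (blk (n + 1)) ≤ C (2 ^ blk (n + 1) + i) := by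
      have := (Nat.le_self_pow (by omega : r ≠ 0) (m (blk (n + 1)))).trans h2
      have := hC (2 ^ blk (n + 1) + i)
      omega
    have h5 : ∑ j ∈ Finset.range i, Q (2 ^ blk (n + 1) + j) ≤
        ∑ j ∈ Finset.range (2 ^ blk (n + 1) + i), Q j := by
      rw [Finset.sum_range_add]
      exact Nat.le_add_left _ _
    exact_mod_cast (Nat.mul_le_mul h4 h5).trans_lt (hQ _)

theorem weigh_vec_strictMono : StrictMono fun n => weigh Q (vec r m n) :=
  strictMono_nat_of_lt_succ (weigh_vec_lt_succ hm1 hmr hr hC hQ)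

theorem vec_injective : Function.Injective (vec r m) := fun _ _ h =>
  (weigh_vec_strictMono hm1 hmr hr hC hQ).injective (congrArg (weigh Q) h)

theorem weigh_vec_pos (n : ℕ) : 0 < weigh Q (vec r m n) := by
  refine lt_of_lt_of_le ?_ ((weigh_vec_strictMono hm1 hmr hr hC hQ).monotone (Nat.zero_le n))
  have hb : blk 0 = 0 := by simp [blk]
  have hp : pos 0 = 0 := by simp [pos, hb]
  have h1 := hm1 0
  have h2 : pos 0 < m (blk 0) ^ r := by rw [hp]; exact Nat.pow_pos (hm1 _)
  rw [weigh_vec_of_lt Q 0 h2]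
  have hQ0 : 0 < Q 0 := (Nat.zero_le _).trans_lt (hQ 0)
  have : 0 ≤ ∑ i ∈ Finset.range r,
      ((pos 0 / m (blk 0) ^ i % m (blk 0) : ℕ) : ℤ) * (Q (2 ^ blk 0 + i) : ℤ) :=
    Finset.sum_nonneg fun i _ => by positivity
  rw [hb] at this ⊢
  have : (0 : ℤ) < Q (2 ^ 0 - 1) := by exact_mod_cast hQ0
  linarith

end

/-! ### Almost sure convergence from moments. -/

/-- The series of the `f j` has finite integral, hence converges almost everywhere, so its terms
tend to zero. -/
theorem tendsto_zero_of_summable_integral {Ω : Type*} [MeasurableSpace Ω] {μ : Measure Ω}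
    {f : ℕ → Ω → ℝ} (hf : ∀ j, Integrable (f j) μ) (h0 : ∀ j ω, 0 ≤ f j ω)
    (hs : Summable fun j => ∫ ω, f j ω ∂μ) :
    ∀ᵐ ω ∂μ, Tendsto (fun j => f j ω) atTop (𝓝 0) := by
  have h1 : ∫⁻ ω, ∑' j, ENNReal.ofReal (f j ω) ∂μ ≠ ⊤ := by
    rw [lintegral_tsum fun j => (hf j).1.aemeasurable.ennreal_ofReal]
    have : ∀ j, ∫⁻ ω, ENNReal.ofReal (f j ω) ∂μ = ENNReal.ofReal (∫ ω, f j ω ∂μ) := fun j =>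
      (ofReal_integral_eq_lintegral_ofReal (hf j) (Eventually.of_forall (h0 j))).symm
    simp_rw [this]
    exact hs.tsum_ofReal_ne_top
  filter_upwards [ae_lt_top' (AEMeasurable.tsum
    fun j => (hf j).1.aemeasurable.ennreal_ofReal) h1] with ω hω
  have h2 := ENNReal.tendsto_atTop_zero_of_tsum_ne_top hω.ne
  have h3 := (ENNReal.tendsto_toReal ENNReal.zero_ne_top).comp h2
  simpa [Function.comp_def, ENNReal.toReal_ofReal (h0 _ _)] using h3

/-- Expanding the square, only `q = p` and `q = σ p` can exceed the independent value `x ^ 2 + ε`,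
and each contributes at most `x`. In the application `σ` is the swap, since `(i, j)` and `(j, i)`
define the same event. -/
theorem integral_sq_count_le {Ω ι : Type*} [MeasurableSpace Ω] {μ : Measure Ω}
    [IsProbabilityMeasure μ] [DecidableEq ι] (P : Finset ι) (σ : ι → ι) {S : ι → Set Ω}
    (hS : ∀ p, MeasurableSet (S p)) {x ε : ℝ} (hx0 : 0 ≤ x) (hε : 0 ≤ ε)
    (hx : ∀ p ∈ P, μ.real (S p) = x)
    (hpq : ∀ p ∈ P, ∀ q ∈ P, q ≠ p → q ≠ σ p → μ.real (S p ∩ S q) ≤ x ^ 2 + ε) :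
    ∫ ω, (∑ p ∈ P, (S p).indicator 1 ω - P.card * x) ^ 2 ∂μ ≤
      2 * P.card * x + P.card ^ 2 * ε := by
  have hi : ∀ p q, Integrable (fun ω => (S p ∩ S q).indicator (1 : Ω → ℝ) ω) μ := fun p q =>
    (integrable_indicator_iff ((hS p).inter (hS q))).2 (integrableOn_const (by finiteness))
  have hi1 : ∀ p, Integrable (fun ω => (S p).indicator (1 : Ω → ℝ) ω) μ := fun p => by
    simpa using hi p p
  have hexp : ∀ ω, (∑ p ∈ P, (S p).indicator (1 : Ω → ℝ) ω - P.card * x) ^ 2 =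
      ∑ p ∈ P, ∑ q ∈ P, (S p ∩ S q).indicator (1 : Ω → ℝ) ω -
        2 * (P.card * x) * ∑ p ∈ P, (S p).indicator (1 : Ω → ℝ) ω + (P.card * x) ^ 2 := by
    intro ω
    have : ∀ p q, (S p ∩ S q).indicator (1 : Ω → ℝ) ω =
        (S p).indicator (1 : Ω → ℝ) ω * (S q).indicator (1 : Ω → ℝ) ω := fun p q => by
      rw [Set.inter_indicator_one]; rfl
    simp_rw [this, ← Finset.mul_sum, ← Finset.sum_mul]
    ring
  simp_rw [hexp]
  have hI1 : Integrable (fun ω => ∑ p ∈ P, ∑ q ∈ P, (S p ∩ S q).indicator (1 : Ω → ℝ) ω) μ :=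
    integrable_finsetSum _ fun p _ => integrable_finsetSum _ fun q _ => hi p q
  have hI2 : Integrable (fun ω => 2 * (P.card * x) * ∑ p ∈ P, (S p).indicator (1 : Ω → ℝ) ω) μ :=
    (integrable_finsetSum _ fun p _ => hi1 p).const_mul _
  have hI3 : Integrable (fun ω => ∑ p ∈ P, ∑ q ∈ P, (S p ∩ S q).indicator (1 : Ω → ℝ) ω -
      2 * (P.card * x) * ∑ p ∈ P, (S p).indicator (1 : Ω → ℝ) ω) μ := hI1.sub hI2
  rw [integral_add hI3 (integrable_const _), integral_sub hI1 hI2, integral_const_mul,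
    integral_finsetSum _ fun p _ => hi1 p,
    integral_finsetSum _ fun p _ => integrable_finsetSum _ fun q _ => hi p q]
  have e1 : ∀ p, ∫ ω, ∑ q ∈ P, (S p ∩ S q).indicator (1 : Ω → ℝ) ω ∂μ =
      ∑ q ∈ P, μ.real (S p ∩ S q) := fun p => by
    rw [integral_finsetSum _ fun q _ => hi p q]
    exact Finset.sum_congr rfl fun q _ => integral_indicator_one ((hS p).inter (hS q))
  have e2 : ∑ p ∈ P, ∫ ω, (S p).indicator (1 : Ω → ℝ) ω ∂μ = P.card * x := by
    rw [Finset.sum_congr rfl fun p hp => (integral_indicator_one (hS p)).trans (hx p hp),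
      Finset.sum_const, nsmul_eq_mul]
  simp_rw [e1]
  rw [e2, integral_const, probReal_univ, one_smul]
  have hb : ∀ p ∈ P, ∑ q ∈ P, μ.real (S p ∩ S q) ≤ P.card * (x ^ 2 + ε) + 2 * x := by
    intro p hp
    have h1 : ∀ q ∈ P, μ.real (S p ∩ S q) ≤ (x ^ 2 + ε) +
        ((if q = p then x else 0) + if q = σ p then x else 0) := by
      intro q hq
      have hle : μ.real (S p ∩ S q) ≤ x := by
        rw [← hx p hp]; exact measureReal_mono Set.inter_subset_left
      have : 0 ≤ x ^ 2 + ε := by positivity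
      by_cases h1 : q = p
      · rw [if_pos h1]
        split_ifs <;> linarith
      · by_cases h2 : q = σ p
        · rw [if_pos h2]
          (split_ifs; linarith)
        · rw [if_neg h1, if_neg h2]
          linarith [hpq p hp q hq h1 h2]
    refine (Finset.sum_le_sum h1).trans ?_
    rw [Finset.sum_add_distrib, Finset.sum_const, nsmul_eq_mul, Finset.sum_add_distrib,
      Finset.sum_ite_eq', Finset.sum_ite_eq']
    split_ifs; all_goals linarith
  have hb2 := Finset.sum_le_card_nsmul _ _ _ hb
  rw [nsmul_eq_mul] at hb2
  nlinarith

/-! ### Counting close pairs -/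

/-- The number of pairs of indices in `P` for which the corresponding multiples of `β` are within
`η` of each other. -/
noncomputable def closePairs (A : ℕ → ℤ) (P : Finset (ℕ × ℕ)) (η : ℝ) (β : UnitAddCircle) : ℕ :=
  (P.filter fun p => ‖(A p.1 - A p.2) • β‖ ≤ η).card

theorem closePairs_eq_sum (A : ℕ → ℤ) (P : Finset (ℕ × ℕ)) (η : ℝ) (β : UnitAddCircle) :
    (closePairs A P η β : ℝ) = ∑ p ∈ P,
      {β : UnitAddCircle | ‖(A p.1 - A p.2) • β‖ ≤ η}.indicator (1 : UnitAddCircle → ℝ) β := by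
  rw [closePairs, Finset.card_filter]
  push_cast
  exact Finset.sum_congr rfl fun p _ => by simp [Set.indicator_apply]

theorem measurableSet_norm_zsmul_le (b : ℤ) (η : ℝ) :
    MeasurableSet {β : UnitAddCircle | ‖b • β‖ ≤ η} :=
  (isClosed_le (by fun_prop) continuous_const).measurableSet

theorem integrable_indicator_zsmul (b : ℤ) (η : ℝ) :
    Integrable ({β : UnitAddCircle | ‖b • β‖ ≤ η}.indicator (1 : UnitAddCircle → ℝ)) :=
  (integrable_indicator_iff (measurableSet_norm_zsmul_le b η)).2
    (integrableOn_const (by finiteness))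

theorem integral_closePairs_le {A : ℕ → ℤ} (hA : Function.Injective A) {P : Finset (ℕ × ℕ)}
    (hP : ∀ p ∈ P, p.1 ≠ p.2) {η : ℝ} (hη : 0 ≤ η) :
    ∫ β, (closePairs A P η β : ℝ) ≤ P.card * (2 * η) := by
  simp_rw [closePairs_eq_sum]
  rw [integral_finsetSum _ fun p _ => integrable_indicator_zsmul _ _]
  refine (Finset.sum_le_card_nsmul _ _ (2 * η) fun p hp => ?_).trans_eq (nsmul_eq_mul _ _)
  rw [integral_indicator_one (measurableSet_norm_zsmul_le _ _),
    volume_zsmul_norm_le (sub_ne_zero.2 (hA.ne (hP p hp))) hη]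
  exact min_le_right _ _

theorem integrable_closePairs (A : ℕ → ℤ) (P : Finset (ℕ × ℕ)) (η : ℝ) :
    Integrable fun β => (closePairs A P η β : ℝ) := by
  simp_rw [closePairs_eq_sum]
  exact integrable_finsetSum _ fun p _ => integrable_indicator_zsmul _ _

theorem closePairs_mono {A : ℕ → ℤ} {P P' : Finset (ℕ × ℕ)} (hP : P ⊆ P') {η η' : ℝ}
    (hη : η ≤ η') (β : UnitAddCircle) : closePairs A P η β ≤ closePairs A P' η' β :=
  Finset.card_le_card fun _ hp => Finset.mem_filter.2
    ⟨hP (Finset.mem_filter.1 hp).1, (Finset.mem_filter.1 hp).2.trans hη⟩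

/-- The pairs below `j ^ 3` that involve an index below `j`. -/
def earlyPairs (j : ℕ) : Finset (ℕ × ℕ) :=
  (Finset.range (j ^ 3)).offDiag.filter fun p => p.1 < j ∨ p.2 < j

/-- The pairs in `[j, j ^ 3)` with different labels. -/
def latePairs (l : ℕ → ℕ) (j : ℕ) : Finset (ℕ × ℕ) :=
  (Finset.range (j ^ 3)).offDiag.filter fun p => j ≤ p.1 ∧ j ≤ p.2 ∧ l p.1 ≠ l p.2

theorem card_earlyPairs_le (j : ℕ) : (earlyPairs j).card ≤ 2 * j * j ^ 3 := by
  have h : earlyPairs j ⊆ Finset.range j ×ˢ Finset.range (j ^ 3) ∪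
      Finset.range (j ^ 3) ×ˢ Finset.range j := by
    intro p hp
    simp only [earlyPairs, Finset.mem_filter, Finset.mem_offDiag, Finset.mem_range] at hp
    simp only [Finset.mem_union, Finset.mem_product, Finset.mem_range]
    tauto
  refine (Finset.card_le_card h).trans ((Finset.card_union_le _ _).trans ?_)
  simp only [Finset.card_product, Finset.card_range]
  linarith

theorem summable_div_sq (c : ℝ) : Summable fun j : ℕ => c / (j : ℝ) ^ 2 := by
  simpa [div_eq_mul_inv] using (Real.summable_nat_pow_inv.2 (by norm_num : 1 < 2)).mul_left c

/-- There are at most `2 * j ^ 4` pairs, each close with probability at most `2 * s / j ^ 3`. After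
division by `j ^ 3` the expectation is at most `4 * s / j ^ 2`, which is summable along the cubes.
-/
theorem ae_tendsto_earlyPairs {A : ℕ → ℤ} (hA : Function.Injective A) {s : ℝ} (hs : 0 ≤ s) :
    ∀ᵐ β : UnitAddCircle, Tendsto (fun j : ℕ =>
      (closePairs A (earlyPairs j) (s / ((j ^ 3 : ℕ) : ℝ)) β : ℝ) / ((j ^ 3 : ℕ) : ℝ))
      atTop (𝓝 0) := by
  refine tendsto_zero_of_summable_integral (fun j => (integrable_closePairs _ _ _).div_const _)
    (fun j β => by positivity) ?_
  refine Summable.of_nonneg_of_le (fun j => integral_nonneg fun β => by positivity)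
    (fun j => ?_) (summable_div_sq (4 * s))
  rw [integral_div]
  rcases Nat.eq_zero_or_pos j with rfl | hj
  · simp
  have hj' : (0 : ℝ) < j := by exact_mod_cast hj
  have h1 := integral_closePairs_le hA (P := earlyPairs j) (fun p hp =>
    (Finset.mem_offDiag.1 (Finset.mem_filter.1 hp).1).2.2)
    (show 0 ≤ s / ((j ^ 3 : ℕ) : ℝ) by positivity)
  have h2 : ((earlyPairs j).card : ℝ) ≤ 2 * j * j ^ 3 := by exact_mod_cast card_earlyPairs_le j
  have h3 : ((earlyPairs j).card : ℝ) * (2 * (s / ((j ^ 3 : ℕ) : ℝ))) ≤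
      2 * j * j ^ 3 * (2 * (s / ((j ^ 3 : ℕ) : ℝ))) :=
    mul_le_mul_of_nonneg_right h2 (by positivity)
  rw [div_le_iff₀ (by positivity)]
  refine (h1.trans h3).trans_eq ?_
  push_cast
  field_simp
  ring

theorem card_latePairs_le (l : ℕ → ℕ) (j : ℕ) : (latePairs l j).card ≤ (j ^ 3) ^ 2 := by
  refine (Finset.card_filter_le _ _).trans ?_
  rw [Finset.offDiag_card, Finset.card_range, sq]
  omega

/-- A relation between the two differences with coefficients up to `K` is a nonzero vector with
entries at most `2 * K * j ^ 3`. Its support consists of coordinates `i` with `j ≤ 2 * i + 2`, where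
`C i` exceeds that bound; this is why early indices are set aside. -/
theorem volume_inter_latePairs_le {r : ℕ} {m : ℕ → ℕ} (hm1 : ∀ k, 1 ≤ m k)
    (hmr : ∀ k, m k ^ r ≤ 2 ^ k) (hr : 1 ≤ r) {C Q : ℕ → ℕ} (hC : ∀ i, 4 * (i + 1) ≤ C i)
    (hQ : ∀ i, C i * ∑ j ∈ Finset.range i, Q j < Q i) {req : ℕ → ℕ}
    (hreq : ∀ j i, j ≤ 2 * i + 2 → req j ≤ C i) {j K : ℕ} {η ε : ℝ}
    (hK : ∀ b : Fin 2 → ℤ,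
      (∀ h : Fin 2 → ℤ, h ≠ 0 → (∀ i, |h i| ≤ K) → ∑ i, h i * b i ≠ 0) →
      volume.real {β : UnitAddCircle | ∀ i, ‖b i • β‖ ≤ η} ≤ (2 * η) ^ 2 + ε)
    (hKj : 2 * K * j ^ 3 ≤ req j) {p q : ℕ × ℕ} (hp : p ∈ latePairs (lab r m) j)
    (hq : q ∈ latePairs (lab r m) j) (hqp : q ≠ p) (hqs : q ≠ p.swap) :
    volume.real
      ({β : UnitAddCircle | ‖(weigh Q (vec r m p.1) - weigh Q (vec r m p.2)) • β‖ ≤ η} ∩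
        {β : UnitAddCircle | ‖(weigh Q (vec r m q.1) - weigh Q (vec r m q.2)) • β‖ ≤ η}) ≤
      (2 * η) ^ 2 + ε := by
  simp only [latePairs, Finset.mem_filter, Finset.mem_offDiag, Finset.mem_range] at hp hq
  obtain ⟨⟨hp1, hp2, -⟩, hp3, hp4, hp5⟩ := hp
  obtain ⟨⟨hq1, hq2, -⟩, hq3, hq4, hq5⟩ := hq
  have hinj := vec_injective hm1 hmr hr hC hQ
  have h := hK ![weigh Q (vec r m p.1) - weigh Q (vec r m p.2),
    weigh Q (vec r m q.1) - weigh Q (vec r m q.2)] ?_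
  · convert h using 2
    ext β
    simp [Fin.forall_fin_two]
  intro h h0 hh
  have e : ∑ i, h i * ![weigh Q (vec r m p.1) - weigh Q (vec r m p.2),
      weigh Q (vec r m q.1) - weigh Q (vec r m q.2)] i =
      weigh Q (h 0 • (vec r m p.1 - vec r m p.2) + h 1 • (vec r m q.1 - vec r m q.2)) := by
    simp [Fin.sum_univ_two, map_add, map_sub]
  rw [e]
  set w := h 0 • (vec r m p.1 - vec r m p.2) + h 1 • (vec r m q.1 - vec r m q.2) with hw
  have hwc : ∀ c, w c = h 0 * (vec r m p.1 c - vec r m p.2 c) +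
      h 1 * (vec r m q.1 c - vec r m q.2 c) := fun c => by simp [hw]
  have hw0 : w ≠ 0 := by
    intro hw0
    obtain ⟨h1, h2⟩ := sub_independent (vec_label (r := r) (m := m)) (vec_lab_eq hm1 hmr) hinj
      hp5 hq5 (fun h => hqp (Prod.ext h.1.symm h.2.symm))
      (fun h => hqs (Prod.ext h.2.symm h.1.symm)) hw0
    apply h0
    funext i
    fin_cases i
    · exact h1
    · exact h2
  refine weigh_ne_zero hQ hw0 fun i hi c _ => ?_
  have hji : j ≤ 2 * i + 2 := by
    have key : ∀ n, j ≤ n → vec r m n i ≠ 0 → j ≤ 2 * i + 2 := fun n hn hne => by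
      have := (index_le_of_vec_ne_zero n i hne).2
      omega
    by_contra hlt
    apply hi
    have hz : ∀ n, j ≤ n → vec r m n i = 0 := fun n hn => by
      by_contra hne
      exact hlt (key n hn hne)
    rw [hwc, hz _ hp3, hz _ hp4, hz _ hq3, hz _ hq4]
    ring
  have hb : ∀ n n', n < j ^ 3 → n' < j ^ 3 → |vec r m n c - vec r m n' c| ≤ (j : ℤ) ^ 3 := by
    have key : ∀ n, n < j ^ 3 → 0 ≤ vec r m n c ∧ vec r m n c ≤ (j : ℤ) ^ 3 := fun n hn => by
      obtain ⟨h1, -, h3⟩ := vec_nonneg_le hm1 hmr hr n c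
      refine ⟨h1, h3.trans ?_⟩
      exact_mod_cast (two_pow_blk_le n).trans hn
    intro n n' hn hn'
    rw [abs_le]
    constructor <;> linarith [(key n hn).1, (key n hn).2, (key n' hn').1, (key n' hn').2]
  have h1 : |w c| ≤ 2 * K * (j : ℤ) ^ 3 := by
    rw [hwc]
    refine (abs_add_le _ _).trans ?_
    rw [abs_mul, abs_mul]
    have h3 := mul_le_mul (hh 0) (hb _ _ hp1 hp2) (abs_nonneg _) (by positivity)
    have h4 := mul_le_mul (hh 1) (hb _ _ hq1 hq2) (abs_nonneg _) (by positivity)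
    linarith
  have h2 : 2 * K * j ^ 3 ≤ C i := hKj.trans (hreq j i hji)
  exact h1.trans (by exact_mod_cast h2)

/-- The normalized second moment is at most `(4 * s + 1) / j ^ 2`. The diagonal gives `4 * s / j ^
3`, and the quasi-independence error over at most `j ^ 12` pairs of pairs gives `j ^ 12 / ((j + 1) ^
8 * j ^ 6)`. -/
theorem ae_tendsto_latePairs {r : ℕ} {m : ℕ → ℕ} (hm1 : ∀ k, 1 ≤ m k)
    (hmr : ∀ k, m k ^ r ≤ 2 ^ k) (hr : 1 ≤ r) {C Q : ℕ → ℕ} (hC : ∀ i, 4 * (i + 1) ≤ C i)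
    (hQ : ∀ i, C i * ∑ j ∈ Finset.range i, Q j < Q i) {req : ℕ → ℕ}
    (hreq : ∀ j i, j ≤ 2 * i + 2 → req j ≤ C i) {s : ℝ} (hs : 0 ≤ s) {K : ℕ → ℕ}
    (hK : ∀ j : ℕ, ∀ b : Fin 2 → ℤ,
      (∀ h : Fin 2 → ℤ, h ≠ 0 → (∀ i, |h i| ≤ K j) → ∑ i, h i * b i ≠ 0) →
      volume.real {β : UnitAddCircle | ∀ i, ‖b i • β‖ ≤ s / ((j ^ 3 : ℕ) : ℝ)} ≤
        (2 * (s / ((j ^ 3 : ℕ) : ℝ))) ^ 2 + 1 / ((j : ℝ) + 1) ^ 8)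
    (hKj : ∀ᶠ j in atTop, 2 * K j * j ^ 3 ≤ req j) :
    ∀ᵐ β : UnitAddCircle, Tendsto (fun j : ℕ =>
      ((closePairs (fun n => weigh Q (vec r m n)) (latePairs (lab r m) j)
        (s / ((j ^ 3 : ℕ) : ℝ)) β : ℝ) -
        (latePairs (lab r m) j).card * (2 * (s / ((j ^ 3 : ℕ) : ℝ)))) / ((j ^ 3 : ℕ) : ℝ))
      atTop (𝓝 0) := by
  set A : ℕ → ℤ := fun n => weigh Q (vec r m n) with hA
  have hAinj : Function.Injective A := (weigh_vec_strictMono hm1 hmr hr hC hQ).injective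
  have hint : ∀ j : ℕ, ∀ c d : ℝ, ∀ η : ℝ, Integrable fun β : UnitAddCircle =>
      (((closePairs A (latePairs (lab r m) j) η β : ℝ) - c) / d) ^ 2 := by
    intro j c d η
    have h1 := (integrable_closePairs A (latePairs (lab r m) j) η).1
    have hm : AEStronglyMeasurable (fun β : UnitAddCircle =>
        (((closePairs A (latePairs (lab r m) j) η β : ℝ) - c) / d) ^ 2) volume :=
      ((((h1.aemeasurable.sub_const c).div_const d).pow_const 2)).aestronglyMeasurable
    refine Integrable.of_bound hm (((latePairs (lab r m) j).card + |c|) ^ 2 / d ^ 2)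
      (Eventually.of_forall fun β => ?_)
    rw [Real.norm_of_nonneg (sq_nonneg _), div_pow]
    refine div_le_div_of_nonneg_right ?_ (sq_nonneg _)
    rw [← sq_abs]
    refine pow_le_pow_left₀ (abs_nonneg _) ((abs_sub _ _).trans ?_) 2
    rw [Nat.abs_cast]
    gcongr
    exact_mod_cast Finset.card_filter_le _ _
  have key := tendsto_zero_of_summable_integral (fun j => hint j
    ((latePairs (lab r m) j).card * (2 * (s / ((j ^ 3 : ℕ) : ℝ)))) ((j ^ 3 : ℕ) : ℝ)
    (s / ((j ^ 3 : ℕ) : ℝ))) (fun j β => sq_nonneg _) ?_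
  · filter_upwards [key] with β hβ
    have h1 := hβ.sqrt
    rw [Real.sqrt_zero] at h1
    simp_rw [Real.sqrt_sq_eq_abs] at h1
    exact (tendsto_zero_iff_abs_tendsto_zero _).2 h1
  · refine Summable.of_norm_bounded_eventually_nat (summable_div_sq (4 * s + 1)) ?_
    -- This ensures `2 * η ≤ 1`, so each event has measure exactly `2 * η`.
    have hev : ∀ᶠ j : ℕ in atTop, 2 * s ≤ j := by
      filter_upwards [eventually_ge_atTop ⌈2 * s⌉₊] with j hj
      exact Nat.ceil_le.1 hj
    filter_upwards [hKj, hev, eventually_ge_atTop 1] with j hj1 hj2 hj3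
    have hj : (1 : ℝ) ≤ j := by exact_mod_cast hj3
    rw [Real.norm_of_nonneg (integral_nonneg fun _ => sq_nonneg _)]
    simp_rw [div_pow]
    rw [integral_div]
    set η : ℝ := s / ((j ^ 3 : ℕ) : ℝ) with hη
    have hη0 : 0 ≤ η := by positivity
    have hη1 : 2 * η ≤ 1 := by
      rw [hη, ← mul_div_assoc, div_le_one (by positivity)]
      push_cast
      nlinarith [mul_self_nonneg ((j : ℝ) - 1)]
    have : IsProbabilityMeasure (volume : Measure UnitAddCircle) :=
      ⟨by simp [AddCircle.measure_univ]⟩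
    have h1 := integral_sq_count_le (μ := (volume : Measure UnitAddCircle))
      (latePairs (lab r m) j) Prod.swap
      (S := fun p => {β : UnitAddCircle | ‖(A p.1 - A p.2) • β‖ ≤ η})
      (fun p => measurableSet_norm_zsmul_le _ _) (x := 2 * η) (ε := 1 / ((j : ℝ) + 1) ^ 8)
      (by positivity) (by positivity) (fun p hp => ?_) (fun p hp q hq hqp hqs =>
        volume_inter_latePairs_le hm1 hmr hr hC hQ hreq (hK j) hj1 hp hq hqp hqs)
    · simp_rw [← closePairs_eq_sum] at h1
      have hc : ((latePairs (lab r m) j).card : ℝ) ≤ (j : ℝ) ^ 6 := by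
        have := card_latePairs_le (lab r m) j
        rw [← pow_mul] at this
        exact_mod_cast this
      have hc0 : (0 : ℝ) ≤ (latePairs (lab r m) j).card := by positivity
      rw [div_le_iff₀ (by positivity)]
      refine h1.trans ?_
      have e1 : (4 * s + 1) / (j : ℝ) ^ 2 * ((j ^ 3 : ℕ) : ℝ) ^ 2 = (4 * s + 1) * (j : ℝ) ^ 4 := by
        push_cast; field_simp
      rw [e1]
      have e2 : 2 * ((latePairs (lab r m) j).card : ℝ) * (2 * η) ≤ 4 * s * (j : ℝ) ^ 4 := by
        calc 2 * ((latePairs (lab r m) j).card : ℝ) * (2 * η) ≤ 2 * (j : ℝ) ^ 6 * (2 * η) := by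
              gcongr
          _ = 4 * s * (j : ℝ) ^ 3 := by
              rw [hη]; push_cast; field_simp; ring
          _ ≤ 4 * s * (j : ℝ) ^ 4 := by
              exact mul_le_mul_of_nonneg_left (pow_le_pow_right₀ hj (by norm_num)) (by positivity)
      have e3 : ((latePairs (lab r m) j).card : ℝ) ^ 2 * (1 / ((j : ℝ) + 1) ^ 8) ≤ (j : ℝ) ^ 4 := by
        rw [mul_one_div, div_le_iff₀ (by positivity)]
        calc ((latePairs (lab r m) j).card : ℝ) ^ 2 ≤ ((j : ℝ) ^ 6) ^ 2 := by gcongr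
          _ = (j : ℝ) ^ 4 * (j : ℝ) ^ 8 := by ring
          _ ≤ (j : ℝ) ^ 4 * ((j : ℝ) + 1) ^ 8 := by gcongr; linarith
      linarith
    · have hp' := (Finset.mem_offDiag.1 (Finset.mem_filter.1 hp).1).2.2
      rw [volume_zsmul_norm_le (sub_ne_zero.2 (hAinj.ne hp')) hη0, min_eq_right hη1]

/-! ### Pairs with equal labels -/

/-- The pairs of distinct indices below `N` with equal labels. -/
def sameLabelPairs (l : ℕ → ℕ) (N : ℕ) : Finset (ℕ × ℕ) :=
  (Finset.range N).offDiag.filter fun p => l p.1 = l p.2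

/-- The pairs of distinct indices in the `k`-th block with equal labels. -/
def blockPairs (l : ℕ → ℕ) (k : ℕ) : Finset (ℕ × ℕ) :=
  (sameLabelPairs l (2 ^ (k + 1))).filter fun p => blk p.1 = k

/-- An index outside the progressions is its own label, while the label of a progression is its
position `0`, which belongs to it since `m ≥ 1`. So a label is shared only within one progression.
-/
theorem of_lab_eq {r : ℕ} {m : ℕ → ℕ} (hm1 : ∀ k, 1 ≤ m k) {i l : ℕ} (hil : i ≠ l)
    (h : lab r m i = lab r m l) :
    blk i = blk l ∧ pos i < m (blk i) ^ r ∧ pos l < m (blk l) ^ r := by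
  have key : ∀ i l : ℕ, i ≠ l → lab r m i = lab r m l → pos i < m (blk i) ^ r := by
    intro i l hil h
    by_contra hi
    rw [lab_of_not i hi] at h
    by_cases hl : pos l < m (blk l) ^ r
    · rw [lab_of_lt l hl] at h
      have h1 : 0 < 2 ^ blk l := by positivity
      have e : i + 1 = 2 ^ blk l + 0 := by omega
      rw [pos_eq e h1] at hi
      exact hi (Nat.pow_pos (hm1 _))
    · rw [lab_of_not l hl] at h
      exact hil h
  have h1 := key i l hil h
  have h2 := key l i hil.symm h.symm
  refine ⟨?_, h1, h2⟩
  rw [lab_of_lt i h1, lab_of_lt l h2] at h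
  have h3 : 0 < 2 ^ blk i := by positivity
  have h4 : 0 < 2 ^ blk l := by positivity
  exact Nat.pow_right_injective le_rfl (show 2 ^ blk i = 2 ^ blk l by omega)

theorem of_mem_blockPairs {r : ℕ} {m : ℕ → ℕ} (hm1 : ∀ k, 1 ≤ m k) {k : ℕ} {p : ℕ × ℕ}
    (hp : p ∈ blockPairs (lab r m) k) : p.1 ≠ p.2 ∧ blk p.1 = k ∧ blk p.2 = k ∧
      pos p.1 < m k ^ r ∧ pos p.2 < m k ^ r := by
  simp only [blockPairs, sameLabelPairs, Finset.mem_filter, Finset.mem_offDiag] at hp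
  obtain ⟨⟨⟨-, -, hne⟩, hl⟩, hk⟩ := hp
  obtain ⟨h1, h2, h3⟩ := of_lab_eq hm1 hne hl
  have h4 : blk p.2 = k := h1.symm.trans hk
  rw [hk] at h2
  rw [h4] at h3
  exact ⟨hne, hk, h4, h2, h3⟩

theorem sameLabelPairs_subset {r : ℕ} {m : ℕ → ℕ} (hm1 : ∀ k, 1 ≤ m k) (N : ℕ) :
    sameLabelPairs (lab r m) N ⊆
      (Finset.range (Nat.log 2 N + 1)).biUnion (blockPairs (lab r m)) := by
  intro p hp
  simp only [sameLabelPairs, Finset.mem_filter, Finset.mem_offDiag, Finset.mem_range] at hp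
  obtain ⟨⟨h1, h2, hne⟩, hl⟩ := hp
  simp only [Finset.mem_biUnion, blockPairs, sameLabelPairs, Finset.mem_filter,
    Finset.mem_offDiag, Finset.mem_range]
  refine ⟨blk p.1, ?_, ⟨⟨?_, ?_, hne⟩, hl⟩, rfl⟩
  · exact Nat.lt_succ_of_le (Nat.log_mono_right h1)
  · have := lt_two_pow_blk p.1; omega
  · rw [(of_lab_eq hm1 hne hl).1]
    have := lt_two_pow_blk p.2; omega

theorem card_blockPairs_le {r : ℕ} {m : ℕ → ℕ} (hm1 : ∀ k, 1 ≤ m k) (k : ℕ) :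
    (blockPairs (lab r m) k).card ≤ m k ^ r * m k ^ r := by
  have h : (blockPairs (lab r m) k).card ≤
      (Finset.range (m k ^ r) ×ˢ Finset.range (m k ^ r)).card := by
    refine Finset.card_le_card_of_injOn (fun p => (pos p.1, pos p.2)) (fun p hp => ?_)
      fun p hp q hq hpq => ?_
    · obtain ⟨-, -, -, h1, h2⟩ := of_mem_blockPairs hm1 hp
      simp [h1, h2]
    · obtain ⟨-, h1, h2, -, -⟩ := of_mem_blockPairs hm1 hp
      obtain ⟨-, h3, h4, -, -⟩ := of_mem_blockPairs hm1 hq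
      have e1 := pos_spec p.1
      have e2 := pos_spec p.2
      have e3 := pos_spec q.1
      have e4 := pos_spec q.2
      rw [h1] at e1
      rw [h2] at e2
      rw [h3] at e3
      rw [h4] at e4
      obtain ⟨h5, h6⟩ := Prod.mk.inj hpq
      exact Prod.ext (by omega) (by omega)
  simpa using h

/-- The value of a vector of digits with respect to the weights of the `k`-th block. -/
def blockHom (Q : ℕ → ℕ) (r k : ℕ) : (Fin r → ℤ) →+ ℤ where
  toFun v := ∑ i, v i * Q (2 ^ k + i)
  map_zero' := by simp
  map_add' v w := by simp [add_mul, Finset.sum_add_distrib]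

/-- The digits of block `k` are carried by weights of index at least `2 ^ k`, where `C` already
exceeds the bound `B`. -/
theorem blockHom_ne_zero {C Q : ℕ → ℕ} (hQ : ∀ i, C i * ∑ j ∈ Finset.range i, Q j < Q i)
    {r k : ℕ} {B : ℤ} (hB : ∀ i, 2 ^ k ≤ i → B ≤ C i) {v : Fin r → ℤ} (hv0 : v ≠ 0)
    (hv : ∀ i, |v i| ≤ B) : blockHom Q r k v ≠ 0 := by
  set w : ℕ →₀ ℤ := ∑ i : Fin r, Finsupp.single (2 ^ k + (i : ℕ)) (v i) with hw
  have e : blockHom Q r k v = weigh Q w := by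
    rw [hw, map_sum]
    simp_rw [weigh_single]
    rfl
  have hwi : ∀ i : Fin r, w (2 ^ k + i) = v i := fun i => by
    rw [hw, Finsupp.finsetSum_apply, Finset.sum_eq_single i, Finsupp.single_eq_same]
    · intro j _ hj
      rw [Finsupp.single_eq_of_ne]
      have : (j : ℕ) ≠ i := fun h => hj (Fin.ext h)
      omega
    · simp
  have hwc : ∀ c, w c ≠ 0 → ∃ i : Fin r, c = 2 ^ k + i := fun c hc => by
    by_contra hne
    push Not at hne
    refine hc ?_
    rw [hw, Finsupp.finsetSum_apply]
    exact Finset.sum_eq_zero fun i _ => Finsupp.single_eq_of_ne (hne i)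
  obtain ⟨i₀, hi₀⟩ := Function.ne_iff.1 hv0
  have hB0 : 0 ≤ B := (abs_nonneg _).trans (hv i₀)
  rw [e]
  refine weigh_ne_zero hQ (fun h => hi₀ ?_) fun i hi c _ => ?_
  · rw [← hwi, h]; rfl
  · obtain ⟨i', rfl⟩ := hwc i hi
    refine le_trans ?_ (hB _ (Nat.le_add_right _ _))
    by_cases hc : w c = 0
    · rw [hc, abs_zero]; exact hB0
    · obtain ⟨c', rfl⟩ := hwc c hc
      rw [hwi]; exact hv c'

/-- A pair is determined by the position of its first member and its digit difference `D`, and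
closeness depends on `D` alone. So each small `D` is responsible for at most `m k ^ r` pairs. -/
theorem closePairs_blockPairs_le {r : ℕ} {m : ℕ → ℕ} (hm1 : ∀ k, 1 ≤ m k)
    {Q : ℕ → ℕ} (hinj : Function.Injective fun n => weigh Q (vec r m n)) (k : ℕ) (η : ℝ)
    (β : UnitAddCircle) :
    closePairs (fun n => weigh Q (vec r m n)) (blockPairs (lab r m) k) η β ≤
      m k ^ r * ((intBox r (m k)).filter
        fun D => D ≠ 0 ∧ ‖blockHom Q r k D • β‖ ≤ η).card := by
  let dig : ℕ → Fin r → ℤ := fun n i => ((pos n / m k ^ (i : ℕ) % m k : ℕ) : ℤ)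
  have hval : ∀ n, blk n = k → pos n < m k ^ r →
      weigh Q (vec r m n) = Q (2 ^ k - 1) + blockHom Q r k (dig n) := by
    intro n h1 h2
    have h2' : pos n < m (blk n) ^ r := by rwa [h1]
    rw [weigh_vec_of_lt Q n h2', h1, Finset.sum_range]
    rfl
  have hdiff : ∀ p ∈ blockPairs (lab r m) k, weigh Q (vec r m p.1) - weigh Q (vec r m p.2) =
      blockHom Q r k (dig p.1 - dig p.2) := by
    intro p hp
    obtain ⟨-, h1, h2, h3, h4⟩ := of_mem_blockPairs hm1 hp
    rw [hval _ h1 h3, hval _ h2 h4, map_sub]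
    ring
  have h : closePairs (fun n => weigh Q (vec r m n)) (blockPairs (lab r m) k) η β ≤
      (Finset.range (m k ^ r) ×ˢ (intBox r (m k)).filter
        fun D => D ≠ 0 ∧ ‖blockHom Q r k D • β‖ ≤ η).card := by
    refine Finset.card_le_card_of_injOn (fun p => (pos p.1, dig p.1 - dig p.2)) (fun p hp => ?_)
      fun p hp q hq hpq => ?_
    · obtain ⟨hp, hpβ⟩ := Finset.mem_filter.1 hp
      obtain ⟨hne, h1, h2, h3, h4⟩ := of_mem_blockPairs hm1 hp
      rw [hdiff p hp] at hpβ
      rw [Finset.mem_coe, Finset.mem_product, Finset.mem_range, Finset.mem_filter, mem_intBox]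
      refine ⟨h3, fun i => ?_, fun h0 => hne (hinj ?_), hpβ⟩
      · have hd : ∀ n, (0 : ℤ) ≤ dig n i ∧ dig n i ≤ m k := fun n =>
          ⟨by positivity, Int.ofNat_le.2 (Nat.mod_lt _ (hm1 k)).le⟩
        change |dig p.1 i - dig p.2 i| ≤ _
        rw [abs_le]
        constructor <;> linarith [(hd p.1).1, (hd p.1).2, (hd p.2).1, (hd p.2).2]
      · have := hdiff p hp
        change dig p.1 - dig p.2 = 0 at h0
        rw [h0, map_zero] at this
        exact sub_eq_zero.1 this
    · have hp := (Finset.mem_filter.1 hp).1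
      have hq := (Finset.mem_filter.1 hq).1
      obtain ⟨-, h1, -, -, -⟩ := of_mem_blockPairs hm1 hp
      obtain ⟨-, h3, -, -, -⟩ := of_mem_blockPairs hm1 hq
      obtain ⟨h5, h6⟩ := Prod.mk.inj hpq
      have e1 := pos_spec p.1
      have e3 := pos_spec q.1
      rw [h1] at e1
      rw [h3] at e3
      have e : p.1 = q.1 := by omega
      refine Prod.ext e (hinj ?_)
      have h7 := hdiff p hp
      have h8 := hdiff q hq
      rw [h6, ← h8, e] at h7
      exact sub_right_injective h7
  rw [Finset.card_product, Finset.card_range] at h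
  exact h

/-- Partial sums of a sequence that is `o(2 ^ k)` are again `o(2 ^ n)`, and `2 ^ (log₂ N + 1) ≤ 2 *
N`. -/
theorem tendsto_sum_dyadic {c : ℕ → ℝ} (hc0 : ∀ k, 0 ≤ c k)
    (hc : Tendsto (fun k => c k / 2 ^ k) atTop (𝓝 0)) :
    Tendsto (fun N : ℕ => (∑ k ∈ Finset.range (Nat.log 2 N + 1), c k) / N) atTop (𝓝 0) := by
  have h1 : c =o[atTop] fun k : ℕ => (2 : ℝ) ^ k :=
    (Asymptotics.isLittleO_iff_tendsto fun k hk => absurd hk (by positivity)).2 hc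
  have hg : ∀ n, ∑ k ∈ Finset.range n, (2 : ℝ) ^ k = 2 ^ n - 1 := fun n => by
    rw [geom_sum_eq (by norm_num)]; norm_num
  have h2 := h1.sum_range (fun k => by positivity) (by
    simp_rw [hg]
    exact tendsto_atTop_add_const_right _ _ (tendsto_pow_atTop_atTop_of_one_lt one_lt_two))
  have h3 : (fun n => ∑ k ∈ Finset.range n, c k) =o[atTop] fun n : ℕ => (2 : ℝ) ^ n := by
    refine h2.trans_isBigO (Asymptotics.IsBigO.of_bound 1 (Eventually.of_forall fun n => ?_))
    rw [hg, one_mul, Real.norm_of_nonneg, Real.norm_of_nonneg (by positivity)]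
    · linarith
    · linarith [one_le_pow₀ (one_le_two (α := ℝ)) (n := n)]
  have h4 := h3.tendsto_div_nhds_zero
  have hlog : Tendsto (fun N => Nat.log 2 N + 1) atTop atTop :=
    (tendsto_add_atTop_nat 1).comp (tendsto_atTop_atTop.2 fun b => ⟨2 ^ b, fun N hN =>
      Nat.le_log_of_pow_le (by norm_num) hN⟩)
  have h5 := (h4.comp hlog).mul_const 2
  rw [zero_mul] at h5
  refine squeeze_zero' (Eventually.of_forall fun N => by
    have := Finset.sum_nonneg fun k (_ : k ∈ Finset.range (Nat.log 2 N + 1)) => hc0 k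
    positivity) ?_ h5
  filter_upwards [eventually_ge_atTop 1] with N hN
  have hs := Finset.sum_nonneg fun k (_ : k ∈ Finset.range (Nat.log 2 N + 1)) => hc0 k
  have hN' : (2 : ℝ) ^ Nat.log 2 N ≤ N := by exact_mod_cast Nat.pow_log_le_self 2 (by omega)
  simp only [Function.comp_apply]
  rw [pow_succ, div_mul_eq_mul_div, mul_div_mul_right _ _ two_ne_zero]
  exact div_le_div_of_nonneg_left hs (by positivity) hN'

/-! ### Choice of the parameters -/

/-- The side length of the progression in the `k`-th block: the largest `x` for which `x ^ r` is at
most `2 ^ k / k ^ (1 / 4)`. -/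
def gapSide (r k : ℕ) : ℕ := Nat.findGreatest (fun x => x ^ (4 * r) * k ≤ 2 ^ (4 * k)) (2 ^ k)

theorem gapSide_upper {r : ℕ} (hr : 1 ≤ r) (k : ℕ) :
    gapSide r k ^ (4 * r) * k ≤ 2 ^ (4 * k) :=
  Nat.findGreatest_spec (P := fun x => x ^ (4 * r) * k ≤ 2 ^ (4 * k)) (Nat.zero_le (2 ^ k))
    (by rw [zero_pow (by omega), zero_mul]; positivity)

theorem gapSide_pos (r k : ℕ) : 1 ≤ gapSide r k := by
  apply Nat.le_findGreatest Nat.one_le_two_pow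
  rw [one_pow, one_mul]
  exact Nat.lt_two_pow_self.le.trans (Nat.pow_le_pow_right (by norm_num) (by omega))

theorem gapSide_pow_le {r : ℕ} (hr : 1 ≤ r) (k : ℕ) : gapSide r k ^ r ≤ 2 ^ k := by
  rcases Nat.eq_zero_or_pos k with rfl | hk
  -- For `k = 0` the defining inequality is vacuous and only the cap `2 ^ k` in the search limits
  -- the side.
  · have : gapSide r 0 ≤ 2 ^ 0 := Nat.findGreatest_le _
    have h1 : gapSide r 0 = 1 := le_antisymm this (gapSide_pos r 0)
    rw [h1, one_pow, pow_zero]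
  · have h := gapSide_upper hr k
    have h2 : gapSide r k ^ (4 * r) ≤ 2 ^ (4 * k) := (Nat.le_mul_of_pos_right _ hk).trans h
    rw [mul_comm 4 r, mul_comm 4 k, pow_mul, pow_mul] at h2
    exact (Nat.pow_le_pow_iff_left (by norm_num)).1 h2

/-- By maximality `gapSide r k + 1` violates the inequality or the cap, and it is at most `2 *
gapSide r k`. -/
theorem gapSide_lower {r : ℕ} (hr : 1 ≤ r) {k : ℕ} (hk : 1 ≤ k) :
    2 ^ (4 * k) ≤ (2 * gapSide r k) ^ (4 * r) * k := by
  have h1 : gapSide r k + 1 ≤ 2 * gapSide r k := by have := gapSide_pos r k; omega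
  refine le_trans ?_ (Nat.mul_le_mul_right k (Nat.pow_le_pow_left h1 (4 * r)))
  by_contra hlt
  rcases Nat.lt_or_ge (2 ^ k) (gapSide r k + 1) with h2 | h2
  · apply hlt
    calc 2 ^ (4 * k) = (2 ^ k) ^ 4 := by rw [← pow_mul, mul_comm]
      _ ≤ (gapSide r k + 1) ^ 4 := Nat.pow_le_pow_left h2.le 4
      _ ≤ (gapSide r k + 1) ^ (4 * r) := Nat.pow_le_pow_right (by omega) (by omega)
      _ ≤ _ := Nat.le_mul_of_pos_right _ hk
  · have := Nat.le_findGreatest (P := fun x => x ^ (4 * r) * k ≤ 2 ^ (4 * k)) h2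
      (by omega)
    change gapSide r k + 1 ≤ gapSide r k at this
    omega

/-- Bertrand's postulate above the integer part of the `d`-th root of `k`; for `k = 0` any prime
will do. -/
theorem exists_prime_pow_near (d : ℕ) (hd : 1 ≤ d) (k : ℕ) :
    ∃ p : ℕ, p.Prime ∧ (1 ≤ k → k < p ^ d ∧ p ^ d ≤ 2 ^ d * k) := by
  rcases Nat.eq_zero_or_pos k with rfl | hk
  · exact ⟨2, Nat.prime_two, fun h => by omega⟩
  set t := Nat.findGreatest (fun x => x ^ d ≤ k) k with ht
  have h1 : 1 ≤ t := Nat.le_findGreatest hk (by rw [one_pow]; exact hk)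
  have h2 : t ^ d ≤ k := Nat.findGreatest_spec (P := fun x => x ^ d ≤ k) (m := 1) hk
    (by rw [one_pow]; exact hk)
  have h3 : k < (t + 1) ^ d := by
    by_contra hlt
    have h4 : t + 1 ≤ k := (Nat.le_self_pow (by omega) _).trans (not_lt.1 hlt)
    have := Nat.le_findGreatest (P := fun x => x ^ d ≤ k) h4 (not_lt.1 hlt)
    omega
  obtain ⟨p, hp, hp1, hp2⟩ := Nat.exists_prime_lt_and_le_two_mul t (by omega)
  refine ⟨p, hp, fun _ => ⟨h3.trans_le (Nat.pow_le_pow_left hp1 d), ?_⟩⟩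
  calc p ^ d ≤ (2 * t) ^ d := Nat.pow_le_pow_left hp2 d
    _ = 2 ^ d * t ^ d := mul_pow _ _ _
    _ ≤ _ := Nat.mul_le_mul_left _ h2

theorem le_rpow_of_pow_le {y c k : ℝ} {n : ℕ} (hn : n ≠ 0) (hc : 0 ≤ c) (hk : 0 < k)
    {e : ℝ} (h : y ^ n ≤ c ^ n * k ^ (e * n)) : y ≤ c * k ^ e := by
  refine le_of_pow_le_pow_left₀ hn (by positivity) (h.trans_eq ?_)
  rw [mul_pow, ← Real.rpow_mul_natCast hk.le]

theorem gapSide_ratio_pow_le {r : ℕ} (hr : 1 ≤ r) (k : ℕ) :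
    ((gapSide r k : ℝ) ^ r / 2 ^ k) ^ 4 * k ≤ 1 := by
  rw [div_pow, div_mul_eq_mul_div, div_le_one (by positivity), ← pow_mul, ← pow_mul,
    mul_comm r, mul_comm k]
  exact_mod_cast gapSide_upper hr k

/-- With `x ≤ k ^ (-1/4)` and `p ≤ 2 * k ^ (1/40)` the exponent of `k` is `a/40 - 10/40`. It is used
with `a = 1` for the exceptional measure and `a = 4` for the number of close pairs. -/
theorem ratio_mul_pow_le {x k p : ℝ} (hk : 0 < k) (h1 : x ^ 4 * k ≤ 1)
    (h2 : p ^ 40 ≤ 2 ^ 40 * k) (a : ℕ) :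
    x * p ^ a ≤ 2 ^ a * k ^ (((a : ℝ) - 10) / 40) := by
  refine le_rpow_of_pow_le (n := 40) (by norm_num) (by positivity) hk ?_
  have e1 : (x * p ^ a) ^ 40 = (x ^ 4) ^ 10 * (p ^ 40) ^ a := by
    rw [mul_pow, ← pow_mul, ← pow_mul, ← pow_mul, mul_comm a]
  have e2 : k ^ (((a : ℝ) - 10) / 40 * (40 : ℕ)) = k ^ a / k ^ 10 := by
    rw [← Real.rpow_natCast, ← Real.rpow_natCast, ← Real.rpow_sub hk]
    congr 1
    push_cast
    ring
  have h3 : x ^ 4 ≤ 1 / k := (le_div_iff₀ hk).2 h1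
  rw [e1, e2]
  calc (x ^ 4) ^ 10 * (p ^ 40) ^ a ≤ (1 / k) ^ 10 * (2 ^ 40 * k) ^ a := by gcongr
    _ = _ := by
      rw [mul_pow, div_pow, one_pow, ← pow_mul, ← pow_mul, mul_comm a]
      ring

theorem tendsto_gapSide_ratio {p : ℕ → ℕ}
    (hp : ∀ k, 1 ≤ k → k < p k ^ 40 ∧ p k ^ 40 ≤ 2 ^ 40 * k) {a : ℕ} (ha : a < 10) :
    Tendsto (fun k => (gapSide 40 k : ℝ) ^ 40 / 2 ^ k * (p k : ℝ) ^ a) atTop (𝓝 0) := by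
  have h1 : Tendsto (fun k : ℕ => (2 : ℝ) ^ a * (k : ℝ) ^ (-((10 - (a : ℝ)) / 40))) atTop
      (𝓝 (2 ^ a * 0)) := by
    refine ((tendsto_rpow_neg_atTop ?_).comp tendsto_natCast_atTop_atTop).const_mul _
    have : (a : ℝ) < 10 := by exact_mod_cast ha
    linarith
  rw [mul_zero] at h1
  refine squeeze_zero' (Eventually.of_forall fun k => by positivity) ?_ h1
  filter_upwards [eventually_ge_atTop 1] with k hk
  have h2 := ratio_mul_pow_le (x := (gapSide 40 k : ℝ) ^ 40 / 2 ^ k) (p := p k)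
    (show (0 : ℝ) < k by exact_mod_cast hk)
    (gapSide_ratio_pow_le (by norm_num) k) (by exact_mod_cast (hp k hk).2) a
  refine h2.trans_eq ?_
  congr 2
  ring

/-- The prime is polynomial in `k` while the side is exponential. The comparison makes a box of side
about `m / p` nondegenerate. -/
theorem eventually_le_gapSide {p : ℕ → ℕ}
    (hp : ∀ k, 1 ≤ k → k < p k ^ 40 ∧ p k ^ 40 ≤ 2 ^ 40 * k) :
    ∀ᶠ k in atTop, p k ≤ gapSide 40 k := by
  have h1 := tendsto_pow_const_div_const_pow_of_one_lt 5 (by norm_num : (1 : ℝ) < 16)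
  have h2 := h1.eventually_le_const (show (0 : ℝ) < 1 / (2 ^ 40) ^ 4 by positivity)
  filter_upwards [h2, eventually_ge_atTop 1] with k hk hk1
  have h3 : (2 ^ 40) ^ 4 * k ^ 5 ≤ 2 ^ (4 * k) := by
    rw [div_le_div_iff₀ (by positivity) (by positivity), one_mul] at hk
    have e : (2 : ℝ) ^ (4 * k) = 16 ^ k := by rw [pow_mul]; norm_num
    have : (((2 ^ 40) ^ 4 * k ^ 5 : ℕ) : ℝ) ≤ ((2 ^ (4 * k) : ℕ) : ℝ) := by
      push_cast
      rw [e]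
      linarith
    exact_mod_cast this
  have h4 : p k ^ (4 * 40) * k ≤ 2 ^ (4 * k) := by
    refine le_trans ?_ h3
    calc p k ^ (4 * 40) * k = (p k ^ 40) ^ 4 * k := by rw [← pow_mul]
      _ ≤ (2 ^ 40 * k) ^ 4 * k := Nat.mul_le_mul_right _ (Nat.pow_le_pow_left (hp k hk1).2 4)
      _ = (2 ^ 40) ^ 4 * k ^ 5 := by ring
  refine Nat.le_findGreatest ?_ h4
  have h5 : p k ^ (4 * 40) ≤ (2 ^ k) ^ (4 * 40) := by
    refine (Nat.le_mul_of_pos_right _ hk1).trans (h4.trans ?_)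
    rw [← pow_mul]
    exact Nat.pow_le_pow_right (by norm_num) (by omega)
  exact (Nat.pow_le_pow_iff_left (by norm_num)).1 h5

/-- Put `y = m ^ 40 * p / 2 ^ k`, which is at most `2 * k ^ (-9/40)`. The five independent vectors
cost `y ^ 5`, of order `k ^ (-9/8)`; the congruent vectors cost `y / p ^ 40`, of order `k ^ (-9/40 -
1)`. The factor 33 is `2 ^ 5 + 1`, and 3 and 5 come from `2 * m + 1 ≤ 3 * m` and `2 * (2 * m / p) +
1 ≤ 5 * (m / p)`. -/
theorem many_small_bound {m p k : ℕ} (hk : 1 ≤ k) (hp1 : k < p ^ 40) (hp2 : p ^ 40 ≤ 2 ^ 40 * k)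
    (hpm : p ≤ m) (hm : ((m : ℝ) ^ 40 / 2 ^ k) ^ 4 * k ≤ 1) :
    ((2 * m + 1 : ℕ) : ℝ) ^ (5 * 40) *
        ((2 * ((p : ℝ) / 2 ^ k)) ^ 5 + ((p : ℝ) / 2 ^ k) ^ 5) +
      ((2 * (2 * m / p) + 1 : ℕ) : ℝ) ^ 40 * (4 * ((p : ℝ) / 2 ^ k)) ≤
      ((3 ^ 40) ^ 5 * 33 * 32 + 5 ^ 40 * 4 * 2) * (k : ℝ) ^ (-(9 / 8) : ℝ) := by
  have hk' : (1 : ℝ) ≤ k := by exact_mod_cast hk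
  have hk0 : (0 : ℝ) < k := by linarith
  have hp0 : 0 < p := by
    rcases Nat.eq_zero_or_pos p with rfl | h
    · simp at hp1
    · exact h
  have hp0' : (0 : ℝ) < p := by exact_mod_cast hp0
  have hpm' : (p : ℝ) ≤ m := by exact_mod_cast hpm
  have hm1 : (1 : ℝ) ≤ m := by exact_mod_cast hp0.trans_le hpm
  set y : ℝ := (m : ℝ) ^ 40 / 2 ^ k * p with hy
  have hy0 : 0 ≤ y := by positivity
  have hyk : y ≤ 2 * (k : ℝ) ^ (-(9 / 40) : ℝ) := by
    have := ratio_mul_pow_le (x := (m : ℝ) ^ 40 / 2 ^ k) (p := p) hk0 hm (by exact_mod_cast hp2) 1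
    rw [pow_one, pow_one] at this
    refine this.trans_eq ?_
    congr 2
    norm_num
  have hy5 : y ^ 5 ≤ 32 * (k : ℝ) ^ (-(9 / 8) : ℝ) := by
    refine (pow_le_pow_left₀ hy0 hyk 5).trans_eq ?_
    rw [mul_pow, ← Real.rpow_mul_natCast hk0.le]
    norm_num
  have hy1 : y / (p : ℝ) ^ 40 ≤ 2 * (k : ℝ) ^ (-(9 / 8) : ℝ) := by
    have h1 : (k : ℝ) ≤ (p : ℝ) ^ 40 := by exact_mod_cast hp1.le
    calc y / (p : ℝ) ^ 40 ≤ 2 * (k : ℝ) ^ (-(9 / 40) : ℝ) / k := by gcongr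
      _ = 2 * (k : ℝ) ^ (-(9 / 40) - 1 : ℝ) := by
        rw [Real.rpow_sub hk0, Real.rpow_one, mul_div_assoc]
      _ ≤ _ := by
        exact mul_le_mul_of_nonneg_left
          (Real.rpow_le_rpow_of_exponent_le hk' (by norm_num)) (by positivity)
  have e1 : ((2 * m + 1 : ℕ) : ℝ) ^ (5 * 40) *
        ((2 * ((p : ℝ) / 2 ^ k)) ^ 5 + ((p : ℝ) / 2 ^ k) ^ 5) ≤ (3 ^ 40) ^ 5 * 33 * y ^ 5 := by
    have h1 : ((2 * m + 1 : ℕ) : ℝ) ≤ 3 * m := by push_cast; linarith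
    calc ((2 * m + 1 : ℕ) : ℝ) ^ (5 * 40) *
        ((2 * ((p : ℝ) / 2 ^ k)) ^ 5 + ((p : ℝ) / 2 ^ k) ^ 5)
        ≤ (3 * (m : ℝ)) ^ (5 * 40) * ((2 * ((p : ℝ) / 2 ^ k)) ^ 5 + ((p : ℝ) / 2 ^ k) ^ 5) := by
          gcongr
      _ = (3 ^ 40) ^ 5 * 33 * y ^ 5 := by
          rw [mul_comm 5 40, pow_mul, mul_pow 3 (m : ℝ) 40, hy]
          generalize (m : ℝ) ^ 40 = M
          generalize (3 : ℝ) ^ 40 = T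
          ring
  have e2 : ((2 * (2 * m / p) + 1 : ℕ) : ℝ) ^ 40 * (4 * ((p : ℝ) / 2 ^ k)) ≤
      5 ^ 40 * 4 * (y / (p : ℝ) ^ 40) := by
    have h1 : ((2 * (2 * m / p) + 1 : ℕ) : ℝ) ≤ 5 * (m / p) := by
      have h2 : ((2 * m / p : ℕ) : ℝ) ≤ 2 * m / p := by
        have := Nat.cast_div_le (α := ℝ) (m := 2 * m) (n := p)
        push_cast at this
        exact this
      have h3 : (1 : ℝ) ≤ m / p := (one_le_div hp0').2 hpm'
      push_cast
      have h4 : (2 : ℝ) * m / p = 2 * (m / p) := by ring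
      linarith
    calc ((2 * (2 * m / p) + 1 : ℕ) : ℝ) ^ 40 * (4 * ((p : ℝ) / 2 ^ k))
        ≤ (5 * ((m : ℝ) / p)) ^ 40 * (4 * ((p : ℝ) / 2 ^ k)) := by gcongr
      _ = 5 ^ 40 * 4 * (y / (p : ℝ) ^ 40) := by
          rw [mul_pow, div_pow, hy]
          generalize (m : ℝ) ^ 40 = M
          generalize (5 : ℝ) ^ 40 = T
          generalize (p : ℝ) ^ 40 = P
          ring
  calc _ ≤ (3 ^ 40) ^ 5 * 33 * y ^ 5 + 5 ^ 40 * 4 * (y / (p : ℝ) ^ 40) := add_le_add e1 e2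
    _ ≤ (3 ^ 40) ^ 5 * 33 * (32 * (k : ℝ) ^ (-(9 / 8) : ℝ)) +
        5 ^ 40 * 4 * (2 * (k : ℝ) ^ (-(9 / 8) : ℝ)) := by gcongr
    _ = _ := by
      generalize ((3 : ℝ) ^ 40) ^ 5 = T
      generalize (5 : ℝ) ^ 40 = T'
      ring

theorem ae_eventually_few_small {C Q : ℕ → ℕ}
    (hQ : ∀ i, C i * ∑ j ∈ Finset.range i, Q j < Q i) {p : ℕ → ℕ} (hpp : ∀ k, (p k).Prime)
    (hp : ∀ k, 1 ≤ k → k < p k ^ 40 ∧ p k ^ 40 ≤ 2 ^ 40 * k) {K : ℕ → ℕ}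
    (hK : ∀ k : ℕ, ∀ b : Fin 5 → ℤ,
      (∀ h : Fin 5 → ℤ, h ≠ 0 → (∀ i, |h i| ≤ K k) → ∑ i, h i * b i ≠ 0) →
      volume.real {β : UnitAddCircle | ∀ i, ‖b i • β‖ ≤ (p k : ℝ) / 2 ^ k} ≤
        (2 * ((p k : ℝ) / 2 ^ k)) ^ 5 + ((p k : ℝ) / 2 ^ k) ^ 5)
    (hreq : ∀ k i, k ≤ 2 * i + 2 → (2 + 5 * K k) * gapSide 40 k ≤ C i) :
    ∀ᵐ β : UnitAddCircle, ∀ᶠ k in atTop, ((intBox 40 (gapSide 40 k)).filter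
      fun D => D ≠ 0 ∧ ‖blockHom Q 40 k D • β‖ ≤ (p k : ℝ) / 2 ^ k).card ≤ p k ^ 4 := by
  classical
  set S : ℕ → Set UnitAddCircle := fun k => {β | p k ^ 4 < ((intBox 40 (gapSide 40 k)).filter
      fun D => D ≠ 0 ∧ ‖blockHom Q 40 k D • β‖ ≤ (p k : ℝ) / 2 ^ k).card} with hS
  have hbound : ∀ᶠ k in atTop, volume.real (S k) ≤
      ((3 ^ 40) ^ 5 * 33 * 32 + 5 ^ 40 * 4 * 2) * (k : ℝ) ^ (-(9 / 8) : ℝ) := by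
    filter_upwards [eventually_le_gapSide hp, eventually_ge_atTop 1] with k hk hk1
    refine le_trans ?_ (many_small_bound hk1 (hp k hk1).1 (hp k hk1).2 hk
      (gapSide_ratio_pow_le (by norm_num) k))
    have h := volume_many_small_le (r := 40) (m := gapSide 40 k) (hpp k) (blockHom Q 40 k)
      (by positivity) (by positivity) (hK k) (fun v hv0 hv => blockHom_ne_zero hQ
        (B := (2 + 5 * K k) * gapSide 40 k) (fun i hi => ?_) hv0 hv)
    · convert h using 5
    · have h1 : k < 2 ^ k := Nat.lt_two_pow_self
      exact_mod_cast hreq k i (by omega)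
  have hsum : Summable fun k => volume.real (S k) := by
    refine Summable.of_norm_bounded_eventually_nat
      ((Real.summable_nat_rpow.2 (by norm_num : (-(9 / 8) : ℝ) < -1)).mul_left
        ((3 ^ 40) ^ 5 * 33 * 32 + 5 ^ 40 * 4 * 2))
      (hbound.mono fun k hk => ?_)
    rwa [Real.norm_of_nonneg measureReal_nonneg]
  have hfin : ∑' k, volume (S k) ≠ ⊤ := by
    have : ∀ k, volume (S k) = ENNReal.ofReal (volume.real (S k)) := fun k => by simp
    simp_rw [this]
    exact hsum.tsum_ofReal_ne_top
  filter_upwards [ae_eventually_notMem hfin] with β hβ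
  filter_upwards [hβ] with k hk
  rw [hS, Set.mem_ofPred_eq, not_lt] at hk
  convert hk

/-- Needed for the main term: almost all pairs have different labels. One of the two factors `m ^
40` is bounded by `N`, and the other is summed dyadically. -/
theorem tendsto_card_sameLabelPairs {p : ℕ → ℕ}
    (hp : ∀ k, 1 ≤ k → k < p k ^ 40 ∧ p k ^ 40 ≤ 2 ^ 40 * k) :
    Tendsto (fun N : ℕ => ((sameLabelPairs (lab 40 (gapSide 40)) N).card : ℝ) / (N : ℝ) ^ 2)
      atTop (𝓝 0) := by
  have h := tendsto_sum_dyadic (c := fun k => (gapSide 40 k : ℝ) ^ 40)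
    (fun k => by positivity) (by simpa using tendsto_gapSide_ratio hp (a := 0) (by norm_num))
  refine squeeze_zero' (Eventually.of_forall fun N => by positivity) ?_ h
  filter_upwards [eventually_ge_atTop 1] with N hN
  have hN' : (0 : ℝ) < N := by exact_mod_cast hN
  have h1 := (Finset.card_le_card (sameLabelPairs_subset (r := 40) (gapSide_pos 40) N)).trans
    (Finset.card_biUnion_le.trans (Finset.sum_le_sum fun k _ =>
      card_blockPairs_le (gapSide_pos 40) k))
  have h2 : ((sameLabelPairs (lab 40 (gapSide 40)) N).card : ℝ) ≤
      ∑ k ∈ Finset.range (Nat.log 2 N + 1), (gapSide 40 k : ℝ) ^ 40 * (gapSide 40 k : ℝ) ^ 40 := by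
    exact_mod_cast h1
  have h3 : ∑ k ∈ Finset.range (Nat.log 2 N + 1), (gapSide 40 k : ℝ) ^ 40 *
      (gapSide 40 k : ℝ) ^ 40 ≤
      ∑ k ∈ Finset.range (Nat.log 2 N + 1), N * (gapSide 40 k : ℝ) ^ 40 := by
    refine Finset.sum_le_sum fun k hk => mul_le_mul_of_nonneg_right ?_ (by positivity)
    have h4 : gapSide 40 k ^ 40 ≤ N := (gapSide_pow_le (by norm_num) k).trans
      (Nat.pow_le_of_le_log (by omega) (by have := Finset.mem_range.1 hk; omega))
    exact_mod_cast h4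
  rw [← Finset.mul_sum] at h3
  rw [div_le_div_iff₀ (by positivity) hN']
  nlinarith

/-- In all but finitely many blocks there are at most `m ^ 40 * p ^ 4 = o(2 ^ k)` close pairs; the
other blocks are bounded trivially. -/
theorem ae_tendsto_sameLabelPairs {C Q : ℕ → ℕ} (hC : ∀ i, 4 * (i + 1) ≤ C i)
    (hQ : ∀ i, C i * ∑ j ∈ Finset.range i, Q j < Q i) {p : ℕ → ℕ} (hpp : ∀ k, (p k).Prime)
    (hp : ∀ k, 1 ≤ k → k < p k ^ 40 ∧ p k ^ 40 ≤ 2 ^ 40 * k) {K : ℕ → ℕ}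
    (hK : ∀ k : ℕ, ∀ b : Fin 5 → ℤ,
      (∀ h : Fin 5 → ℤ, h ≠ 0 → (∀ i, |h i| ≤ K k) → ∑ i, h i * b i ≠ 0) →
      volume.real {β : UnitAddCircle | ∀ i, ‖b i • β‖ ≤ (p k : ℝ) / 2 ^ k} ≤
        (2 * ((p k : ℝ) / 2 ^ k)) ^ 5 + ((p k : ℝ) / 2 ^ k) ^ 5)
    (hreq : ∀ k i, k ≤ 2 * i + 2 → (2 + 5 * K k) * gapSide 40 k ≤ C i) :
    ∀ᵐ β : UnitAddCircle, ∀ s : ℝ, 0 ≤ s → Tendsto (fun N : ℕ =>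
      (closePairs (fun n => weigh Q (vec 40 (gapSide 40) n))
        (sameLabelPairs (lab 40 (gapSide 40)) N) (s / N) β : ℝ) / N) atTop (𝓝 0) := by
  classical
  filter_upwards [ae_eventually_few_small hQ hpp hp hK hreq] with β hβ s hs
  set A : ℕ → ℤ := fun n => weigh Q (vec 40 (gapSide 40) n) with hA
  have hAinj : Function.Injective A := (weigh_vec_strictMono (gapSide_pos 40)
    (gapSide_pow_le (by norm_num)) (by norm_num) hC hQ).injective
  -- The tolerance `p k / 2 ^ k` does not involve `s`, and `p k` tends to infinity, so a single null
  -- set serves all `s`.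
  set good : ℕ → Prop := fun k => s ≤ p k ∧ ((intBox 40 (gapSide 40 k)).filter
      fun D => D ≠ 0 ∧ ‖blockHom Q 40 k D • β‖ ≤ (p k : ℝ) / 2 ^ k).card ≤ p k ^ 4 with hgood
  set c : ℕ → ℕ := fun k => if good k then gapSide 40 k ^ 40 * p k ^ 4 else
    gapSide 40 k ^ 40 * gapSide 40 k ^ 40 with hcdef
  have hev : ∀ᶠ k in atTop, good k := by
    filter_upwards [hβ, eventually_ge_atTop (⌈s⌉₊ ^ 40), eventually_ge_atTop 1] with k h1 h2 h3
    refine ⟨?_, h1⟩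
    have h4 : ⌈s⌉₊ ^ 40 ≤ p k ^ 40 := h2.trans (hp k h3).1.le
    have h5 : ⌈s⌉₊ ≤ p k := (Nat.pow_le_pow_iff_left (by norm_num)).1 h4
    exact Nat.ceil_le.1 h5
  have hc : Tendsto (fun k => (c k : ℝ) / 2 ^ k) atTop (𝓝 0) := by
    refine (tendsto_gapSide_ratio hp (a := 4) (by norm_num)).congr' ?_
    filter_upwards [hev] with k hk
    rw [hcdef]
    simp only [if_pos hk]
    push_cast
    ring
  refine squeeze_zero' (Eventually.of_forall fun N => by positivity) ?_
    (tendsto_sum_dyadic (fun k => Nat.cast_nonneg (c k)) hc)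
  filter_upwards [eventually_ge_atTop 1] with N hN
  refine div_le_div_of_nonneg_right ?_ (by positivity)
  have hblock : ∀ k ∈ Finset.range (Nat.log 2 N + 1),
      closePairs A (blockPairs (lab 40 (gapSide 40)) k) (s / N) β ≤ c k := by
    intro k hk
    by_cases hg : good k
    · simp only [hcdef, if_pos hg]
      have h2k : (2 : ℝ) ^ k ≤ N := by
        exact_mod_cast Nat.pow_le_of_le_log (by omega : N ≠ 0)
          (by have := Finset.mem_range.1 hk; omega)
      have hle : s / N ≤ (p k : ℝ) / 2 ^ k :=
        div_le_div₀ (by positivity) hg.1 (by positivity) h2k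
      refine (closePairs_mono (Finset.Subset.refl _) hle β).trans
        ((closePairs_blockPairs_le (gapSide_pos 40) hAinj k _ β).trans
          (Nat.mul_le_mul_left _ ?_))
      convert hg.2
    · simp only [hcdef, if_neg hg]
      exact (Finset.card_filter_le _ _).trans (card_blockPairs_le (gapSide_pos 40) k)
  have h1 : closePairs A (sameLabelPairs (lab 40 (gapSide 40)) N) (s / N) β ≤
      ∑ k ∈ Finset.range (Nat.log 2 N + 1), c k := by
    refine (closePairs_mono (sameLabelPairs_subset (gapSide_pos 40) N) le_rfl β).trans
      (le_trans ?_ (Finset.sum_le_sum hblock))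
    rw [closePairs, Finset.filter_biUnion]
    exact Finset.card_biUnion_le
  exact_mod_cast h1

/-! ### Poissonian pair correlations -/

/-- Early and equal-label pairs are negligible both in number and among the close pairs, so the late
pairs alone give the limit. -/
theorem tendsto_closePairs_cubes {A : ℕ → ℤ} {l : ℕ → ℕ} {β : UnitAddCircle} {s : ℝ}
    (hlate : Tendsto (fun j : ℕ => ((closePairs A (latePairs l j) (s / ((j ^ 3 : ℕ) : ℝ)) β : ℝ) -
      (latePairs l j).card * (2 * (s / ((j ^ 3 : ℕ) : ℝ)))) / ((j ^ 3 : ℕ) : ℝ)) atTop (𝓝 0))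
    (hearly : Tendsto (fun j : ℕ =>
      (closePairs A (earlyPairs j) (s / ((j ^ 3 : ℕ) : ℝ)) β : ℝ) / ((j ^ 3 : ℕ) : ℝ))
      atTop (𝓝 0))
    (hsame : Tendsto (fun N : ℕ => (closePairs A (sameLabelPairs l N) (s / N) β : ℝ) / N)
      atTop (𝓝 0))
    (hcard : Tendsto (fun N : ℕ => ((sameLabelPairs l N).card : ℝ) / (N : ℝ) ^ 2) atTop (𝓝 0)) :
    Tendsto (fun j : ℕ => (closePairs A (Finset.range (j ^ 3)).offDiag
      (s / ((j ^ 3 : ℕ) : ℝ)) β : ℝ) / ((j ^ 3 : ℕ) : ℝ)) atTop (𝓝 (2 * s)) := by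
  have hcube : Tendsto (fun j : ℕ => j ^ 3) atTop atTop := tendsto_pow_atTop (by norm_num)
  have hsame' := hsame.comp hcube
  have hcard' := hcard.comp hcube
  simp only [Function.comp_def] at hsame' hcard'
  have hsub : ∀ j, (Finset.range (j ^ 3)).offDiag ⊆
      latePairs l j ∪ (earlyPairs j ∪ sameLabelPairs l (j ^ 3)) := by
    intro j p hp
    simp only [latePairs, earlyPairs, sameLabelPairs, Finset.mem_union, Finset.mem_filter, hp,
      true_and]
    by_cases h1 : p.1 < j
    · tauto
    by_cases h2 : p.2 < j
    · tauto
    rw [not_lt] at h1 h2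
    tauto
  have hlc : Tendsto (fun j : ℕ => ((latePairs l j).card : ℝ) / ((j ^ 3 : ℕ) : ℝ) ^ 2) atTop
      (𝓝 1) := by
    -- The term `3 / j` absorbs the at most `2 * j ^ 4` early pairs and the `j ^ 3` diagonal ones,
    -- relative to `j ^ 6`.
    have hinv : Tendsto (fun j : ℕ => (1 : ℝ) - 3 * ((j : ℝ))⁻¹ -
        ((sameLabelPairs l (j ^ 3)).card : ℝ) / ((j ^ 3 : ℕ) : ℝ) ^ 2) atTop (𝓝 (1 - 3 * 0 - 0)) :=
      (tendsto_const_nhds.sub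
        ((tendsto_inv_atTop_zero.comp tendsto_natCast_atTop_atTop).const_mul 3)).sub hcard'
    rw [mul_zero, sub_zero, sub_zero] at hinv
    refine tendsto_of_tendsto_of_tendsto_of_le_of_le' hinv tendsto_const_nhds ?_ ?_
    · filter_upwards [eventually_ge_atTop 1] with j hj
      have hj' : (1 : ℝ) ≤ j := by exact_mod_cast hj
      have h1 := (Finset.card_le_card (hsub j)).trans ((Finset.card_union_le _ _).trans
        (Nat.add_le_add_left (Finset.card_union_le _ _) _))
      have h2 := card_earlyPairs_le j
      rw [Finset.offDiag_card, Finset.card_range] at h1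
      have h3 : j ^ 3 * j ^ 3 ≤ (latePairs l j).card + 2 * j * j ^ 3 +
          (sameLabelPairs l (j ^ 3)).card + j ^ 3 := by omega
      have h4 : (j : ℝ) ^ 3 * (j : ℝ) ^ 3 ≤ (latePairs l j).card + 2 * j * (j : ℝ) ^ 3 +
          (sameLabelPairs l (j ^ 3)).card + (j : ℝ) ^ 3 := by exact_mod_cast h3
      push_cast
      have h5 : 3 * ((j : ℝ))⁻¹ = 3 * (j : ℝ) ^ 5 / ((j : ℝ) ^ 3) ^ 2 := by
        field_simp
      rw [h5, le_div_iff₀ (by positivity), sub_mul, sub_mul, div_mul_cancel₀ _ (by positivity),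
        div_mul_cancel₀ _ (by positivity)]
      have h6 : (j : ℝ) * (j : ℝ) ^ 3 ≤ (j : ℝ) ^ 5 := by
        rw [← pow_succ']; exact pow_le_pow_right₀ hj' (by norm_num)
      have h7 : (j : ℝ) ^ 3 ≤ (j : ℝ) ^ 5 := pow_le_pow_right₀ hj' (by norm_num)
      nlinarith
    · filter_upwards with j
      refine div_le_one_of_le₀ ?_ (by positivity)
      exact_mod_cast card_latePairs_le l j
  have hmain : Tendsto (fun j : ℕ =>
      (closePairs A (latePairs l j) (s / ((j ^ 3 : ℕ) : ℝ)) β : ℝ) / ((j ^ 3 : ℕ) : ℝ)) atTop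
      (𝓝 (2 * s)) := by
    have h := hlate.add (hlc.mul_const (2 * s))
    rw [zero_add, one_mul] at h
    refine h.congr' ?_
    filter_upwards [eventually_ge_atTop 1] with j hj
    have hj' : (0 : ℝ) < ((j ^ 3 : ℕ) : ℝ) := by positivity
    field_simp
    ring
  have hup := hmain.add (hearly.add hsame')
  rw [add_zero, add_zero] at hup
  refine tendsto_of_tendsto_of_tendsto_of_le_of_le hmain hup (fun j => ?_) fun j => ?_
  · refine div_le_div_of_nonneg_right ?_ (by positivity)
    exact Nat.cast_le.2 (closePairs_mono (Finset.filter_subset _ _) le_rfl β)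
  · change _ ≤ (_ / _ + (_ / _ + _ / _))
    rw [← add_div, ← add_div]
    refine div_le_div_of_nonneg_right ?_ (by positivity)
    have h1 := closePairs_mono (A := A) (hsub j) (le_refl (s / ((j ^ 3 : ℕ) : ℝ))) β
    have h2 : closePairs A (latePairs l j ∪ (earlyPairs j ∪ sameLabelPairs l (j ^ 3)))
        (s / ((j ^ 3 : ℕ) : ℝ)) β ≤ closePairs A (latePairs l j) (s / ((j ^ 3 : ℕ) : ℝ)) β +
        (closePairs A (earlyPairs j) (s / ((j ^ 3 : ℕ) : ℝ)) β +
        closePairs A (sameLabelPairs l (j ^ 3)) (s / ((j ^ 3 : ℕ) : ℝ)) β) := by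
      simp only [closePairs, Finset.filter_union]
      exact (Finset.card_union_le _ _).trans (Nat.add_le_add_left (Finset.card_union_le _ _) _)
    have h3 : ((_ : ℕ) : ℝ) ≤ _ := Nat.cast_le.2 (h1.trans h2)
    rwa [Nat.cast_add, Nat.cast_add] at h3

/-- The fractions `a / (b + 1)` form a countable dense family of parameters, so the exceptional null
sets can be united. -/
theorem exists_nat_div_btwn {x y : ℝ} (hx : 0 ≤ x) (hxy : x < y) :
    ∃ a b : ℕ, x < (a : ℝ) / (b + 1) ∧ (a : ℝ) / (b + 1) < y := by
  obtain ⟨q, h1, h2⟩ := exists_rat_btwn hxy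
  have hq : 0 < q := by exact_mod_cast hx.trans_lt h1
  have e : ((q.num.toNat : ℝ)) / (((q.den - 1 : ℕ) : ℝ) + 1) = q := by
    have h3 : ((q.den - 1 : ℕ) : ℝ) + 1 = q.den := by
      exact_mod_cast Nat.sub_add_cancel q.den_pos
    have h4 : ((q.num.toNat : ℕ) : ℝ) = q.num := by
      exact_mod_cast Int.toNat_of_nonneg (Rat.num_nonneg.2 hq.le)
    rw [h3, h4]
    exact_mod_cast Rat.num_div_den q
  exact ⟨_, _, by rwa [e], by rwa [e]⟩

theorem tendsto_cube_ratio : Tendsto (fun j : ℕ => ((j : ℝ) + 1) ^ 3 / (j : ℝ) ^ 3) atTop (𝓝 1) := by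
  have h := ((tendsto_inv_atTop_zero.comp
    (tendsto_natCast_atTop_atTop (R := ℝ))).const_add 1).pow 3
  rw [add_zero, one_pow] at h
  refine h.congr' ?_
  filter_upwards [eventually_ge_atTop 1] with j hj
  have : (j : ℝ) ≠ 0 := by positivity
  simp only [Function.comp_apply]
  field_simp

/-- The count increases with the range and with the tolerance. For `j ^ 3 ≤ N ≤ (j + 1) ^ 3` it lies
between those at the two cubes, and a rational parameter slightly below or above `s` absorbs the
ratio of the cubes, which tends to 1. -/
theorem tendsto_closePairs_of_cubes {A : ℕ → ℤ} {β : UnitAddCircle}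
    (h : ∀ a b : ℕ, Tendsto (fun j : ℕ => (closePairs A (Finset.range (j ^ 3)).offDiag
      ((a : ℝ) / (b + 1) / ((j ^ 3 : ℕ) : ℝ)) β : ℝ) / ((j ^ 3 : ℕ) : ℝ)) atTop
      (𝓝 (2 * ((a : ℝ) / (b + 1))))) {s : ℝ} (hs : 0 ≤ s) :
    Tendsto (fun N : ℕ => (closePairs A (Finset.range N).offDiag (s / N) β : ℝ) / N) atTop
      (𝓝 (2 * s)) := by
  let root : ℕ → ℕ := fun N => Nat.findGreatest (fun j => j ^ 3 ≤ N) N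
  have hroot1 : ∀ N, root N ^ 3 ≤ N := fun N =>
    Nat.findGreatest_spec (P := fun j => j ^ 3 ≤ N) (Nat.zero_le N) (by simp)
  have hroot2 : ∀ N, N ≤ (root N + 1) ^ 3 := fun N => by
    by_contra hlt
    have h1 : root N + 1 ≤ N := (Nat.le_self_pow (by norm_num) _).trans (not_le.1 hlt).le
    have h2 : root N + 1 ≤ root N :=
      Nat.le_findGreatest (P := fun j => j ^ 3 ≤ N) h1 (not_le.1 hlt).le
    omega
  have hroot : Tendsto root atTop atTop := tendsto_atTop_atTop.2 fun b => ⟨b ^ 3, fun N hN =>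
    Nat.le_findGreatest ((Nat.le_self_pow (by norm_num) _).trans hN) hN⟩
  have hratio := tendsto_cube_ratio
  have hratio' : Tendsto (fun j : ℕ => (j : ℝ) ^ 3 / ((j : ℝ) + 1) ^ 3) atTop (𝓝 1) := by
    simpa using hratio.inv₀ one_ne_zero
  have hmono : ∀ (P P' : ℕ) (x y : ℝ), P ≤ P' → x ≤ y →
      (closePairs A (Finset.range P).offDiag x β : ℝ) ≤
        closePairs A (Finset.range P').offDiag y β := fun P P' x y h1 h2 => by
    exact_mod_cast closePairs_mono (Finset.offDiag_mono (Finset.range_mono h1)) h2 β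
  refine tendsto_order.2 ⟨fun u hu => ?_, fun u hu => ?_⟩
  · rcases lt_or_ge u 0 with hu0 | hu0
    · exact Eventually.of_forall fun N => hu0.trans_le (by positivity)
    obtain ⟨a, b, h1, h2⟩ := exists_nat_div_btwn (x := u / 2) (y := s) (by positivity) (by linarith)
    have hab := h a b
    have ht0 : 0 ≤ (a : ℝ) / (b + 1) := by positivity
    generalize (a : ℝ) / (b + 1) = t at hab h1 h2 ht0
    have e1 := (hab.mul hratio').eventually_const_lt (show u < 2 * t * 1 by linarith)
    have e2 := (hratio.const_mul t).eventually_lt_const (show t * 1 < s by linarith)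
    filter_upwards [hroot.eventually e1, hroot.eventually e2,
      hroot.eventually (eventually_ge_atTop 1)] with N h3 h4 h5
    set j := root N
    have hj : (0 : ℝ) < (j : ℝ) ^ 3 := by positivity
    have hN1 : (j : ℝ) ^ 3 ≤ N := by exact_mod_cast hroot1 N
    have hN2 : (N : ℝ) ≤ ((j : ℝ) + 1) ^ 3 := by exact_mod_cast hroot2 N
    have hN0 : (0 : ℝ) < N := hj.trans_le hN1
    refine h3.trans_le ?_
    have h6 : t / ((j ^ 3 : ℕ) : ℝ) ≤ s / N := by
      push_cast
      rw [← mul_div_assoc, div_lt_iff₀ hj] at h4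
      rw [div_le_div_iff₀ hj hN0]
      nlinarith
    calc _ = (closePairs A (Finset.range (j ^ 3)).offDiag (t / ((j ^ 3 : ℕ) : ℝ)) β : ℝ) /
          ((j : ℝ) + 1) ^ 3 := by
          generalize (closePairs A _ _ β : ℝ) = x
          push_cast
          field_simp
      _ ≤ (closePairs A (Finset.range N).offDiag (s / N) β : ℝ) / N :=
        div_le_div₀ (by positivity) (hmono _ _ _ _ (hroot1 N) h6) hN0 hN2
  · obtain ⟨a, b, h1, h2⟩ := exists_nat_div_btwn (x := s) (y := u / 2) hs (by linarith)
    have hab := h a b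
    have ht0 : 0 ≤ (a : ℝ) / (b + 1) := by positivity
    generalize (a : ℝ) / (b + 1) = t at hab h1 h2 ht0
    have e1 := ((hab.comp (tendsto_add_atTop_nat 1)).mul hratio).eventually_lt_const
      (show 2 * t * 1 < u by linarith)
    have e2 := (hratio.const_mul s).eventually_lt_const (show s * 1 < t by linarith)
    filter_upwards [hroot.eventually e1, hroot.eventually e2,
      hroot.eventually (eventually_ge_atTop 1)] with N h3 h4 h5
    set j := root N
    have hj : (0 : ℝ) < (j : ℝ) ^ 3 := by positivity
    have hN1 : (j : ℝ) ^ 3 ≤ N := by exact_mod_cast hroot1 N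
    have hN0 : (0 : ℝ) < N := hj.trans_le hN1
    refine lt_of_le_of_lt ?_ h3
    have h6 : s / N ≤ t / (((j + 1) ^ 3 : ℕ) : ℝ) := by
      push_cast
      rw [← mul_div_assoc, div_lt_iff₀ hj] at h4
      rw [div_le_div_iff₀ hN0 (by positivity)]
      nlinarith
    calc (closePairs A (Finset.range N).offDiag (s / N) β : ℝ) / N
        ≤ (closePairs A (Finset.range ((j + 1) ^ 3)).offDiag
          (t / (((j + 1) ^ 3 : ℕ) : ℝ)) β : ℝ) / (j : ℝ) ^ 3 :=
        div_le_div₀ (by positivity) (hmono _ _ _ _ (hroot2 N) h6) hj hN1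
      _ = _ := by
        simp only [Function.comp_apply]
        generalize (closePairs A _ _ β : ℝ) = x
        push_cast
        field_simp

theorem ae_coe_of_ae {G : UnitAddCircle → Prop} (h : ∀ᵐ β, G β) :
    ∀ᵐ α : ℝ, G (α : UnitAddCircle) := by
  have h1 : ∀ n : ℤ, ∀ᵐ α : ℝ ∂volume.restrict (Set.Ioc (n : ℝ) (n + 1)),
      G (α : UnitAddCircle) := fun n =>
    (AddCircle.measurePreserving_mk 1 (n : ℝ)).quasiMeasurePreserving.ae h
  have h2 := (ae_restrict_iUnion_iff (μ := (volume : Measure ℝ))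
    (fun n : ℤ => Set.Ioc (n : ℝ) (n + 1)) (fun α : ℝ => G (α : UnitAddCircle))).2 h1
  rwa [iUnion_Ioc_intCast, Measure.restrict_univ] at h2

theorem pairCorrelation_fract (a : ℕ → ℕ) (α s : ℝ) (N : ℕ) :
    pairCorrelation (fun n => Int.fract ((a n : ℝ) * α)) s N =
      (closePairs (fun n => (a n : ℤ)) (Finset.range N).offDiag (s / N)
        (α : UnitAddCircle) : ℝ) / N := by
  have h : ∀ i j : ℕ, distNearestInt (Int.fract ((a i : ℝ) * α) - Int.fract ((a j : ℝ) * α)) =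
      ‖((a i : ℤ) - (a j : ℤ)) • (α : UnitAddCircle)‖ := by
    intro i j
    rw [distNearestInt, ← UnitAddCircle.norm_eq]
    congr 1
    have hf : ∀ x : ℝ, ((Int.fract x : ℝ) : UnitAddCircle) = x := fun x => by
      have h0 : ((⌊x⌋ : ℝ) : UnitAddCircle) = 0 :=
        (AddCircle.coe_eq_zero_iff (1 : ℝ)).2 ⟨⌊x⌋, by simp⟩
      rw [← Int.self_sub_floor, AddCircle.coe_sub, h0, sub_zero]
    rw [AddCircle.coe_sub, hf, hf, sub_zsmul, ← AddCircle.coe_zsmul, ← AddCircle.coe_zsmul]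
    simp [sub_eq_add_neg]
  simp only [pairCorrelation, closePairs, h]

/-! ### Additive energy -/

/-- The indices of the progression in the `k`-th block. -/
def gapIndices (M k : ℕ) : Finset ℕ := (Finset.range M).image fun i => 2 ^ k - 1 + i

theorem card_gapIndices (M k : ℕ) : (gapIndices M k).card = M := by
  rw [gapIndices, Finset.card_image_of_injective _ (add_right_injective _), Finset.card_range]

theorem mem_gapIndices {M k n : ℕ} (hM : M ≤ 2 ^ k) :
    n ∈ gapIndices M k ↔ blk n = k ∧ pos n < M := by
  have h0 : 0 < 2 ^ k := by positivity
  simp only [gapIndices, Finset.mem_image, Finset.mem_range]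
  constructor
  · rintro ⟨i, hi, rfl⟩
    have e : 2 ^ k - 1 + i + 1 = 2 ^ k + i := by omega
    exact ⟨blk_eq e (hi.trans_le hM), by rwa [pos_eq e (hi.trans_le hM)]⟩
  · rintro ⟨rfl, h⟩
    exact ⟨pos n, h, by have := pos_spec n; omega⟩

section

variable {r : ℕ} {m : ℕ → ℕ} (hm1 : ∀ k, 1 ≤ m k) (hmr : ∀ k, m k ^ r ≤ 2 ^ k)
  (hr : 1 ≤ r) {C Q : ℕ → ℕ} (hC : ∀ i, 4 * (i + 1) ≤ C i)
  (hQ : ∀ i, C i * ∑ j ∈ Finset.range i, Q j < Q i) {a : ℕ → ℕ}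
  (ha : ∀ n, (a n : ℤ) = weigh Q (vec r m n))

include hm1 hmr

/-- Triples suffice because three members of an additive quadruple determine the fourth. A triple
with one label is constant or lies in one progression. -/
theorem card_sameLabel_triples_le (N : ℕ) :
    ((Finset.range N ×ˢ Finset.range N ×ˢ Finset.range N).filter fun x : ℕ × ℕ × ℕ =>
      lab r m x.2.1 = lab r m x.1 ∧ lab r m x.2.2 = lab r m x.1).card ≤
      N + ∑ k ∈ Finset.range (Nat.log 2 N + 1), (m k ^ r) ^ 3 := by
  have hsub : ((Finset.range N ×ˢ Finset.range N ×ˢ Finset.range N).filter fun x : ℕ × ℕ × ℕ =>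
      lab r m x.2.1 = lab r m x.1 ∧ lab r m x.2.2 = lab r m x.1) ⊆
      (Finset.range N).image (fun i => (i, i, i)) ∪
      (Finset.range (Nat.log 2 N + 1)).biUnion fun k => gapIndices (m k ^ r) k ×ˢ
        gapIndices (m k ^ r) k ×ˢ gapIndices (m k ^ r) k := by
    rintro ⟨i, l, j⟩ hx
    simp only [Finset.mem_filter, Finset.mem_product, Finset.mem_range] at hx
    obtain ⟨⟨hi, hl, hj⟩, h1, h2⟩ := hx
    simp only [Finset.mem_union, Finset.mem_image, Finset.mem_biUnion, Finset.mem_product,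
      Finset.mem_range, mem_gapIndices (hmr _), Prod.mk.injEq]
    by_cases hd : l = i ∧ j = i
    · left; exact ⟨i, hi, rfl, hd.1.symm, hd.2.symm⟩
    · right
      have hi' : pos i < m (blk i) ^ r := by
        by_cases hli : l = i
        · have hji : j ≠ i := fun h => hd ⟨hli, h⟩
          exact (of_lab_eq hm1 hji.symm h2.symm).2.1
        · exact (of_lab_eq hm1 (Ne.symm hli) h1.symm).2.1
      have key : ∀ x, lab r m x = lab r m i → blk x = blk i ∧ pos x < m (blk i) ^ r := by
        intro x hx
        rcases eq_or_ne x i with rfl | hne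
        · exact ⟨rfl, hi'⟩
        · obtain ⟨h3, h4, h5⟩ := of_lab_eq hm1 hne hx
          exact ⟨h3, by rwa [h3] at h4⟩
      exact ⟨blk i, Nat.lt_succ_of_le (Nat.log_mono_right hi), ⟨rfl, hi'⟩, key l h1, key j h2⟩
  refine (Finset.card_le_card hsub).trans ((Finset.card_union_le _ _).trans ?_)
  refine Nat.add_le_add ?_ ?_
  · exact Finset.card_image_le.trans (Finset.card_range N).le
  · refine Finset.card_biUnion_le.trans (Finset.sum_le_sum fun k _ => ?_)
    rw [Finset.card_product, Finset.card_product, card_gapIndices]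
    exact le_of_eq (by ring)

include hr hC hQ ha

/-- Passing to integers creates no new additive quadruples: the entries of the difference of the two
sums are below `4 * (c' + 1)`, which explains the condition on `C`. -/
theorem vec_add_eq_of_add_eq {i j l p : ℕ} (h : a i + a j = a l + a p) :
    vec r m i + vec r m j = vec r m l + vec r m p := by
  by_contra hne
  refine weigh_ne_zero hQ (sub_ne_zero.2 hne) (fun c _ c' hc' => ?_) ?_
  · have hb := fun n => vec_nonneg_le hm1 hmr hr n c'
    have h1 : 4 * ((c' : ℤ) + 1) ≤ C c := by
      have := hC c
      exact_mod_cast (by omega : 4 * (c' + 1) ≤ C c)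
    simp only [Finsupp.sub_apply, Finsupp.add_apply]
    rw [abs_le]
    obtain ⟨hi1, hi2, -⟩ := hb i
    obtain ⟨hj1, hj2, -⟩ := hb j
    obtain ⟨hl1, hl2, -⟩ := hb l
    obtain ⟨hp1, hp2, -⟩ := hb p
    constructor <;> linarith
  · rw [map_sub, map_add, map_add, ← ha, ← ha, ← ha, ← ha]
    have : (a i : ℤ) + a j = a l + a p := by exact_mod_cast h
    linarith

theorem initialEnergy_le (N : ℕ) : initialEnergy a N ≤
    2 * N ^ 2 + (N + ∑ k ∈ Finset.range (Nat.log 2 N + 1), (m k ^ r) ^ 3) := by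
  have hainj : Function.Injective a := fun x y h =>
    (weigh_vec_strictMono hm1 hmr hr hC hQ).injective (by
      rw [← ha, ← ha, h])
  set I := Finset.range N
  set T := (I ×ˢ I ×ˢ I).filter fun x : ℕ × ℕ × ℕ =>
      lab r m x.2.1 = lab r m x.1 ∧ lab r m x.2.2 = lab r m x.1 with hT
  have hcard : initialEnergy a N ≤
      (((I ×ˢ I).disjSum (I ×ˢ I)).disjSum T).card := by
    -- The two kinds of trivial quadruples are parametrized by pairs, the others by triples of
    -- indices with equal labels. The truncated subtraction is exact on actual quadruples.
    refine Finset.card_le_card_of_surjOn (fun x : ((ℕ × ℕ) ⊕ (ℕ × ℕ)) ⊕ (ℕ × ℕ × ℕ) =>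
      match x with
      | .inl (.inl (i, j)) => ((a i, a i), (a j, a j))
      | .inl (.inr (i, j)) => ((a i, a j), (a j, a i))
      | .inr (i, l, j) => ((a i, a l), (a j, a i + a j - a l))) ?_
    rintro ⟨⟨x₁, x₂⟩, y₁, y₂⟩ hx
    simp only [initialSegment, Finset.coe_filter, Finset.mem_product, Finset.mem_image,
      Set.mem_ofPred_eq] at hx
    obtain ⟨⟨⟨⟨i, hi, rfl⟩, l, hl, rfl⟩, ⟨j, hj, rfl⟩, p, hp, rfl⟩, h⟩ := hx
    rcases add_eq_add_cases (vec_label (r := r) (m := m)) (vec_lab_eq hm1 hmr)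
      (vec_injective hm1 hmr hr hC hQ) (vec_add_eq_of_add_eq hm1 hmr hr hC hQ ha h) with
      ⟨rfl, rfl⟩ | ⟨rfl, rfl⟩ | ⟨h1, h2, h3⟩
    · exact ⟨.inl (.inl (i, j)), by simp [I] at hi hj ⊢; exact ⟨hi, hj⟩, rfl⟩
    · exact ⟨.inl (.inr (i, j)), by simp [I] at hi hj ⊢; exact ⟨hi, hj⟩, rfl⟩
    · refine ⟨.inr (i, l, j), ?_, ?_⟩
      · simp only [Finset.mem_coe, Finset.inr_mem_disjSum, hT, Finset.mem_filter,
          Finset.mem_product]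
        exact ⟨⟨hi, hl, hj⟩, h2, h1⟩
      · simp only [Prod.mk.injEq, true_and]
        omega
  refine hcard.trans ?_
  have hI : I.card = N := Finset.card_range N
  rw [Finset.card_disjSum, Finset.card_disjSum, Finset.card_product, hI]
  have hTcard : T.card ≤ N + ∑ k ∈ Finset.range (Nat.log 2 N + 1), (m k ^ r) ^ 3 :=
    card_sameLabel_triples_le hm1 hmr N
  have e : N * N + N * N = 2 * N ^ 2 := by ring
  omega

open Pointwise in
-- Cauchy–Schwarz: `|B| ^ 4 ≤ |B + B| * E(B)` for the progression `B` of block `k`. Digitwise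
-- addition puts `B + B` in a progression of side `2 * m k`, so `|B + B| ≤ 2 ^ r * |B|`.
theorem le_initialEnergy {k N : ℕ} (hk : 2 ^ (k + 1) ≤ N + 1) :
    (m k ^ r) ^ 3 ≤ 2 ^ r * initialEnergy a N := by
  have hainj : Function.Injective a := fun x y h =>
    (weigh_vec_strictMono hm1 hmr hr hC hQ).injective (by
      rw [← ha, ← ha, h])
  set B := (gapIndices (m k ^ r) k).image a with hB
  have hBcard : B.card = m k ^ r := by
    rw [hB, Finset.card_image_of_injective _ hainj, card_gapIndices]
  have hBsub : B ⊆ initialSegment a N := by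
    refine Finset.image_subset_image fun n hn => ?_
    rw [mem_gapIndices (hmr k)] at hn
    have := lt_two_pow_blk n
    rw [hn.1] at this
    exact Finset.mem_range.2 (by omega)
  have hE : B.addEnergy B ≤ initialEnergy a N := Finset.addEnergy_mono hBsub hBsub
  have hsum : (B + B).card ≤ (2 * m k) ^ r := by
    have hsub : (B + B).image (fun x : ℕ => (x : ℤ)) ⊆
        (Fintype.piFinset fun _ : Fin r => Finset.range (2 * m k)).image
          fun v => 2 * (Q (2 ^ k - 1) : ℤ) + ∑ i : Fin r, (v i : ℤ) * Q (2 ^ k + i) := by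
      intro z hz
      obtain ⟨x, hx, rfl⟩ := Finset.mem_image.1 hz
      obtain ⟨y₁, hy₁, y₂, hy₂, rfl⟩ := Finset.mem_add.1 hx
      obtain ⟨n₁, hn₁, rfl⟩ := Finset.mem_image.1 hy₁
      obtain ⟨n₂, hn₂, rfl⟩ := Finset.mem_image.1 hy₂
      rw [mem_gapIndices (hmr k)] at hn₁ hn₂
      have hval : ∀ n, blk n = k ∧ pos n < m k ^ r → (a n : ℤ) = Q (2 ^ k - 1) +
          ∑ i : Fin r, ((pos n / m k ^ (i : ℕ) % m k : ℕ) : ℤ) * Q (2 ^ k + i) := by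
        rintro n ⟨h1, h2⟩
        rw [ha, weigh_vec_of_lt Q n (by rwa [h1]), h1, Finset.sum_range]
      refine Finset.mem_image.2 ⟨fun i => pos n₁ / m k ^ (i : ℕ) % m k +
        pos n₂ / m k ^ (i : ℕ) % m k, ?_, ?_⟩
      · rw [Fintype.mem_piFinset]
        intro i
        have h1 := Nat.mod_lt (pos n₁ / m k ^ (i : ℕ)) (hm1 k)
        have h2 := Nat.mod_lt (pos n₂ / m k ^ (i : ℕ)) (hm1 k)
        exact Finset.mem_range.2 (by omega)
      · rw [Nat.cast_add, hval _ hn₁, hval _ hn₂]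
        simp only [Nat.cast_add, add_mul, Finset.sum_add_distrib]
        ring
    have h := (Finset.card_le_card hsub).trans Finset.card_image_le
    rw [Finset.card_image_of_injective _ Nat.cast_injective, Fintype.card_piFinset,
      Finset.prod_const, Finset.card_range, Finset.card_univ, Fintype.card_fin] at h
    exact h
  have hCS := Finset.le_card_add_mul_addEnergy B B
  rw [hBcard] at hCS
  have h1 : (m k ^ r) ^ 2 * (m k ^ r) ^ 2 ≤ (2 ^ r * m k ^ r) * initialEnergy a N := by
    rw [← mul_pow 2 (m k) r]
    exact hCS.trans (Nat.mul_le_mul hsum hE)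
  have hpos : 0 < m k ^ r := Nat.pow_pos (hm1 k)
  refine Nat.le_of_mul_le_mul_left ?_ hpos
  calc m k ^ r * (m k ^ r) ^ 3 = (m k ^ r) ^ 2 * (m k ^ r) ^ 2 := by ring
    _ ≤ _ := h1
    _ = _ := by ring

end

/-! ### Order of magnitude of the energy. -/

theorem rpow_three_quarters_eq {κ : ℝ} (hκ : 0 ≤ κ) :
    ∃ t : ℝ, 0 ≤ t ∧ t ^ 4 = κ ∧ κ ^ (3 / 4 : ℝ) = t ^ 3 := by
  refine ⟨κ ^ (1 / 4 : ℝ), by positivity, ?_, ?_⟩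
  · rw [← Real.rpow_mul_natCast hκ]; norm_num
  · rw [← Real.rpow_mul_natCast hκ]; norm_num

theorem cube_mul_rpow_le {x y κ : ℝ} (hy : 0 ≤ y) (hκ : 0 ≤ κ)
    (h : x ^ 4 * κ ≤ y ^ 4) (hx : 0 ≤ x) : x ^ 3 * κ ^ (3 / 4 : ℝ) ≤ y ^ 3 := by
  obtain ⟨t, ht0, rfl, ht⟩ := rpow_three_quarters_eq hκ
  rw [ht, ← mul_pow]
  rw [← mul_pow] at h
  exact pow_le_pow_left₀ (by positivity) (le_of_pow_le_pow_left₀ (by norm_num) hy h) 3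

theorem cube_le_mul_rpow {x y κ : ℝ} (hy : 0 ≤ y) (hκ : 0 ≤ κ)
    (h : y ^ 4 ≤ x ^ 4 * κ) (hx : 0 ≤ x) : y ^ 3 ≤ x ^ 3 * κ ^ (3 / 4 : ℝ) := by
  obtain ⟨t, ht0, rfl, ht⟩ := rpow_three_quarters_eq hκ
  rw [ht, ← mul_pow]
  rw [← mul_pow] at h
  exact pow_le_pow_left₀ hy (le_of_pow_le_pow_left₀ (by norm_num) (by positivity) h) 3

theorem rpow_le_two_mul {x y : ℝ} (hx : 0 ≤ x) (hy : 0 ≤ y) (h : x ≤ 2 * y) :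
    x ^ (3 / 4 : ℝ) ≤ 2 * y ^ (3 / 4 : ℝ) := by
  calc x ^ (3 / 4 : ℝ) ≤ (2 * y) ^ (3 / 4 : ℝ) := by gcongr
    _ = 2 ^ (3 / 4 : ℝ) * y ^ (3 / 4 : ℝ) := Real.mul_rpow (by norm_num) hy
    _ ≤ 2 ^ (1 : ℝ) * y ^ (3 / 4 : ℝ) := mul_le_mul_of_nonneg_right
        (Real.rpow_le_rpow_of_exponent_le (by norm_num) (by norm_num)) (by positivity)
    _ = _ := by rw [Real.rpow_one]

/-- The terms grow almost geometrically with ratio 8, so the last one dominates. The induction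
closes because `2 * 16 + 64 ≤ 8 * 16`. -/
theorem sum_gapSide_cubes_le (n : ℕ) :
    (∑ k ∈ Finset.range (n + 1), ((gapSide 40 k : ℝ) ^ 40) ^ 3) * ((n : ℝ) + 1) ^ (3 / 4 : ℝ) ≤
      16 * (2 ^ n) ^ 3 := by
  have hterm : ∀ k : ℕ, ((gapSide 40 k : ℝ) ^ 40) ^ 3 * ((k : ℝ) + 1) ^ (3 / 4 : ℝ) ≤
      (2 * 2 ^ k) ^ 3 := by
    intro k
    refine cube_mul_rpow_le (by positivity) (by positivity) ?_ (by positivity)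
    have h1 := gapSide_ratio_pow_le (r := 40) (by norm_num) k
    rw [div_pow, div_mul_eq_mul_div, div_le_one (by positivity)] at h1
    have h2 : (gapSide 40 k : ℝ) ^ 40 ≤ 2 ^ k := by
      exact_mod_cast gapSide_pow_le (r := 40) (by norm_num) k
    have h3 : ((gapSide 40 k : ℝ) ^ 40) ^ 4 ≤ (2 ^ k) ^ 4 := pow_le_pow_left₀ (by positivity) h2 4
    rw [mul_pow]
    generalize (gapSide 40 k : ℝ) ^ 40 = M at *
    nlinarith [pow_pos (pow_pos (two_pos (α := ℝ)) k) 4]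
  induction n with
  | zero =>
    have := hterm 0
    simp only [Nat.cast_zero, zero_add, Finset.sum_range_one, Real.one_rpow, mul_one,
      pow_zero] at this ⊢
    linarith
  | succ n ih =>
    rw [Finset.sum_range_succ, add_mul]
    have h1 := hterm (n + 1)
    have h2 : ((n : ℝ) + 1 + 1) ^ (3 / 4 : ℝ) ≤ 2 * ((n : ℝ) + 1) ^ (3 / 4 : ℝ) :=
      rpow_le_two_mul (by positivity) (by positivity) (by linarith [Nat.cast_nonneg (α := ℝ) n])
    have h3 : 0 ≤ ∑ k ∈ Finset.range (n + 1), ((gapSide 40 k : ℝ) ^ 40) ^ 3 :=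
      Finset.sum_nonneg fun k _ => by positivity
    have h4 := mul_le_mul_of_nonneg_left h2 h3
    push_cast at h1 ⊢
    have e1 : ((2 : ℝ) ^ (n + 1)) ^ 3 = 8 * (2 ^ n) ^ 3 := by ring
    have e2 : (2 * (2 : ℝ) ^ (n + 1)) ^ 3 = 64 * (2 ^ n) ^ 3 := by ring
    rw [e2] at h1
    rw [e1]
    have h5 : (0 : ℝ) ≤ (2 ^ n) ^ 3 := by positivity
    linarith

theorem log_bounds {N : ℕ} (hN : 1 ≤ N) :
    1 + Real.log N ≤ 2 * ((Nat.log 2 N : ℝ) + 1) ∧ (Nat.log 2 N : ℝ) + 1 ≤ 2 * (1 + Real.log N) := by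
  have hN' : (0 : ℝ) < N := by exact_mod_cast hN
  have h2 := Real.log_two_gt_d9
  have h3 := Real.log_two_lt_d9
  have hK : (0 : ℝ) ≤ Nat.log 2 N := by positivity
  constructor
  · have h1 : (N : ℝ) ≤ 2 ^ (Nat.log 2 N + 1) := by
      exact_mod_cast (Nat.lt_pow_succ_log_self (by norm_num) N).le
    have h4 := Real.log_le_log hN' h1
    rw [Real.log_pow] at h4
    push_cast at h4
    nlinarith
  · have h1 : (2 : ℝ) ^ Nat.log 2 N ≤ N := by
      exact_mod_cast Nat.pow_log_le_self 2 (by omega)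
    have h4 := Real.log_le_log (by positivity) h1
    rw [Real.log_pow] at h4
    nlinarith

theorem gap_energy_bounds {a : ℕ → ℕ}
    (hle : ∀ N, initialEnergy a N ≤
      2 * N ^ 2 + (N + ∑ k ∈ Finset.range (Nat.log 2 N + 1), (gapSide 40 k ^ 40) ^ 3))
    (hge : ∀ k N, 2 ^ (k + 1) ≤ N + 1 → (gapSide 40 k ^ 40) ^ 3 ≤ 2 ^ 40 * initialEnergy a N)
    {N : ℕ} (hN : 1 ≤ N) :
    1 / (128 * 2 ^ 160) * ((N : ℝ) ^ 3 * (1 + Real.log N) ^ (-(3 / 4) : ℝ)) ≤ initialEnergy a N ∧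
      (initialEnergy a N : ℝ) ≤ 38 * ((N : ℝ) ^ 3 * (1 + Real.log N) ^ (-(3 / 4) : ℝ)) := by
  have hN' : (1 : ℝ) ≤ N := by exact_mod_cast hN
  have hlog : 0 ≤ Real.log N := Real.log_nonneg hN'
  obtain ⟨hl1, hl2⟩ := log_bounds hN
  have hψ : 0 < (1 + Real.log N) ^ (3 / 4 : ℝ) := by positivity
  rw [Real.rpow_neg (by positivity), ← div_eq_mul_inv, ← mul_div_assoc, ← mul_div_assoc,
    div_le_iff₀ hψ, le_div_iff₀ hψ]
  constructor
  -- `k` is the last block contained in the first `N` indices, so `N ≤ 4 * 2 ^ k`.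
  · obtain ⟨k, hk⟩ : ∃ k, Nat.log 2 (N + 1) = k + 1 :=
      ⟨Nat.log 2 (N + 1) - 1, by have := Nat.log_pos (b := 2) (by norm_num) (show 2 ≤ N + 1 by omega); omega⟩
    have hk1 : 2 ^ (k + 1) ≤ N + 1 := by rw [← hk]; exact Nat.pow_log_le_self 2 (by omega)
    have hk2 : N + 1 < 2 ^ (k + 1 + 1) := by
      rw [← hk]; exact Nat.lt_pow_succ_log_self (by norm_num) _
    have hkN : 2 ^ k ≤ N := by rw [pow_succ] at hk1; omega
    have hkK : (k : ℝ) ≤ Nat.log 2 N := by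
      exact_mod_cast Nat.le_log_of_pow_le (by norm_num) hkN
    have h1 : ((gapSide 40 k : ℝ) ^ 40) ^ 3 ≤ 2 ^ 40 * initialEnergy a N := by
      exact_mod_cast hge k N hk1
    have h2 : ((2 : ℝ) ^ k) ^ 4 ≤ (2 ^ 40 * (gapSide 40 k : ℝ) ^ 40) ^ 4 * ((k : ℝ) + 1) := by
      have hcast : 2 ^ (4 * k) ≤ (2 * gapSide 40 k) ^ (4 * 40) * (k + 1) := by
        rcases Nat.eq_zero_or_pos k with rfl | hk0
        · have := gapSide_pos 40 0
          exact Nat.one_le_iff_ne_zero.2 (by positivity)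
        · exact (gapSide_lower (by norm_num) hk0).trans (Nat.mul_le_mul_left _ (Nat.le_succ k))
      rw [← mul_pow, ← pow_mul, ← pow_mul, mul_comm k, mul_comm 40 4]
      exact_mod_cast hcast
    have h3 := cube_le_mul_rpow (by positivity) (by positivity) h2 (by positivity)
    have h4 : ((k : ℝ) + 1) ^ (3 / 4 : ℝ) ≤ 2 * (1 + Real.log N) ^ (3 / 4 : ℝ) :=
      rpow_le_two_mul (by positivity) (by positivity) (by linarith)
    have h5 : (N : ℝ) ≤ 4 * 2 ^ k := by
      have : N ≤ 4 * 2 ^ k := by rw [pow_succ, pow_succ] at hk2; omega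
      exact_mod_cast this
    rw [div_mul_eq_mul_div, one_mul, div_le_iff₀ (by positivity)]
    calc (N : ℝ) ^ 3 ≤ (4 * 2 ^ k) ^ 3 := pow_le_pow_left₀ (by positivity) h5 3
      _ = 64 * (2 ^ k) ^ 3 := by ring
      _ ≤ 64 * ((2 ^ 40 * (gapSide 40 k : ℝ) ^ 40) ^ 3 * ((k : ℝ) + 1) ^ (3 / 4 : ℝ)) := by gcongr
      _ = 64 * ((2 ^ 40) ^ 3 * ((gapSide 40 k : ℝ) ^ 40) ^ 3 * ((k : ℝ) + 1) ^ (3 / 4 : ℝ)) := by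
        rw [mul_pow]
      _ ≤ 64 * ((2 ^ 40) ^ 3 * (2 ^ 40 * initialEnergy a N) *
          (2 * (1 + Real.log N) ^ (3 / 4 : ℝ))) := by gcongr
      _ = _ := by
        generalize (1 + Real.log N) ^ (3 / 4 : ℝ) = t
        ring
  · have h1 : (initialEnergy a N : ℝ) ≤ 2 * (N : ℝ) ^ 2 + (N +
        ∑ k ∈ Finset.range (Nat.log 2 N + 1), ((gapSide 40 k : ℝ) ^ 40) ^ 3) := by
      exact_mod_cast hle N
    have h2 := sum_gapSide_cubes_le (Nat.log 2 N)
    have h3 : (1 + Real.log N) ^ (3 / 4 : ℝ) ≤ 2 * ((Nat.log 2 N : ℝ) + 1) ^ (3 / 4 : ℝ) :=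
      rpow_le_two_mul (by positivity) (by positivity) hl1
    have h4 : (2 : ℝ) ^ Nat.log 2 N ≤ N := by exact_mod_cast Nat.pow_log_le_self 2 (by omega)
    have h5 : ((2 : ℝ) ^ Nat.log 2 N) ^ 3 ≤ (N : ℝ) ^ 3 := pow_le_pow_left₀ (by positivity) h4 3
    have h6 : ((Nat.log 2 N : ℝ) + 1) ^ (3 / 4 : ℝ) ≤ N := by
      have h7 : (Nat.log 2 N : ℝ) + 1 ≤ N := by
        exact_mod_cast (Nat.lt_two_pow_self (n := Nat.log 2 N)).trans_le
          (Nat.pow_log_le_self 2 (by omega))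
      refine le_trans ?_ h7
      calc ((Nat.log 2 N : ℝ) + 1) ^ (3 / 4 : ℝ) ≤ ((Nat.log 2 N : ℝ) + 1) ^ (1 : ℝ) :=
            Real.rpow_le_rpow_of_exponent_le (by linarith [Nat.cast_nonneg (α := ℝ) (Nat.log 2 N)])
              (by norm_num)
        _ = _ := Real.rpow_one _
    have h8 : 0 ≤ ((Nat.log 2 N : ℝ) + 1) ^ (3 / 4 : ℝ) := by positivity
    set t := ((Nat.log 2 N : ℝ) + 1) ^ (3 / 4 : ℝ)
    -- The trivial quadruples contribute at most `3 * N ^ 3`, since `t ≤ N`, and the progressions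
    -- `16 * N ^ 3`.
    have h9 : (initialEnergy a N : ℝ) * t ≤ 19 * (N : ℝ) ^ 3 := by
      have h10 := mul_le_mul_of_nonneg_right h1 h8
      have h11 : (2 * (N : ℝ) ^ 2 + N) * t ≤ (2 * (N : ℝ) ^ 2 + N) * N :=
        mul_le_mul_of_nonneg_left h6 (by positivity)
      nlinarith
    calc (initialEnergy a N : ℝ) * (1 + Real.log N) ^ (3 / 4 : ℝ) ≤ initialEnergy a N * (2 * t) := by
          gcongr
      _ ≤ _ := by linarith

/-! ### Construction of the sequence and conclusion. -/

theorem exists_metric_sequence : ∃ a : ℕ → ℕ, StrictMono a ∧ (∀ n, 0 < a n) ∧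
    MetricPairCorrelationProperty a ∧ ∃ c D : ℝ, 0 < c ∧ 0 < D ∧ ∀ N : ℕ, 1 ≤ N →
      c * ((N : ℝ) ^ 3 * (1 + Real.log N) ^ (-(3 / 4) : ℝ)) ≤ initialEnergy a N ∧
      (initialEnergy a N : ℝ) ≤ D * ((N : ℝ) ^ 3 * (1 + Real.log N) ^ (-(3 / 4) : ℝ)) := by
  choose p hpp hp using exists_prime_pow_near 40 (by norm_num)
  have hpp0 : ∀ k, (0 : ℝ) < p k := fun k => by exact_mod_cast (hpp k).pos
  choose K₅ hK₅ using fun k : ℕ => exists_relation_bound 5 (η := (p k : ℝ) / 2 ^ k)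
    (ε := ((p k : ℝ) / 2 ^ k) ^ 5) (by positivity) (by have := hpp0 k; positivity)
  choose K₂ hK₂ using fun a b j : ℕ => exists_relation_bound 2
    (η := (a : ℝ) / (b + 1) / ((j ^ 3 : ℕ) : ℝ)) (ε := 1 / ((j : ℝ) + 1) ^ 8)
    (by positivity) (by positivity)
  -- At stage `j` only the finitely many parameters `a / (b + 1)` with `a, b ≤ j` are provided for;
  -- each parameter is covered from some stage on.
  set req : ℕ → ℕ := fun j => (∑ x ∈ Finset.range (j + 1) ×ˢ Finset.range (j + 1),
    2 * K₂ x.1 x.2 j * j ^ 3) + (2 + 5 * K₅ j) * gapSide 40 j with hreqdef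
  -- Coordinate `i` has to meet only the requirements of stages `j ≤ 2 * i + 2`, so their sum is
  -- finite.
  set C : ℕ → ℕ := fun i => 4 * (i + 1) + ∑ j ∈ Finset.range (2 * i + 3), req j with hCdef
  obtain ⟨Q, hQ⟩ := exists_rapid C
  have hC : ∀ i, 4 * (i + 1) ≤ C i := fun i => Nat.le_add_right _ _
  have hreq : ∀ j i, j ≤ 2 * i + 2 → req j ≤ C i := fun j i hj =>
    (Finset.single_le_sum (f := req) (fun _ _ => Nat.zero_le _)
      (Finset.mem_range.2 (by omega))).trans (Nat.le_add_left _ _)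
  have hm1 := gapSide_pos 40
  have hmr := gapSide_pow_le (r := 40) (by norm_num)
  have hmono := weigh_vec_strictMono hm1 hmr (by norm_num) hC hQ
  have hpos := weigh_vec_pos hm1 hmr (by norm_num) hC hQ
  set A : ℕ → ℤ := fun n => weigh Q (vec 40 (gapSide 40) n) with hA
  have ha : ∀ n, (((A n).toNat : ℕ) : ℤ) = A n := fun n => Int.toNat_of_nonneg (hpos n).le
  refine ⟨fun n => (A n).toNat, fun i j hij => ?_, fun n => ?_, ?_, 1 / (128 * 2 ^ 160), 38,
    by positivity, by norm_num, fun N hN => ?_⟩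
  · have := hmono hij
    have h1 := ha i
    have h2 := ha j
    change (A i).toNat < (A j).toNat
    omega
  · have := ha n
    have h1 : 0 < A n := hpos n
    change 0 < (A n).toNat
    omega
  · have hlate : ∀ᵐ β : UnitAddCircle, ∀ a b : ℕ, Tendsto (fun j : ℕ =>
        ((closePairs A (latePairs (lab 40 (gapSide 40)) j)
          ((a : ℝ) / (b + 1) / ((j ^ 3 : ℕ) : ℝ)) β : ℝ) -
          (latePairs (lab 40 (gapSide 40)) j).card *
            (2 * ((a : ℝ) / (b + 1) / ((j ^ 3 : ℕ) : ℝ)))) / ((j ^ 3 : ℕ) : ℝ))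
        atTop (𝓝 0) := by
      rw [ae_all_iff]; intro a
      rw [ae_all_iff]; intro b
      refine ae_tendsto_latePairs hm1 hmr (by norm_num) hC hQ hreq (by positivity) (hK₂ a b) ?_
      filter_upwards [eventually_ge_atTop a, eventually_ge_atTop b] with j ha hb
      refine le_trans ?_ (Nat.le_add_right _ _)
      exact Finset.single_le_sum (f := fun x : ℕ × ℕ => 2 * K₂ x.1 x.2 j * j ^ 3)
        (fun _ _ => Nat.zero_le _) (show (a, b) ∈ _ from Finset.mem_product.2
          ⟨Finset.mem_range.2 (Nat.lt_succ_of_le ha), Finset.mem_range.2 (Nat.lt_succ_of_le hb)⟩)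
    have hearly : ∀ᵐ β : UnitAddCircle, ∀ a b : ℕ, Tendsto (fun j : ℕ =>
        (closePairs A (earlyPairs j) ((a : ℝ) / (b + 1) / ((j ^ 3 : ℕ) : ℝ)) β : ℝ) /
          ((j ^ 3 : ℕ) : ℝ)) atTop (𝓝 0) := by
      rw [ae_all_iff]; intro a
      rw [ae_all_iff]; intro b
      exact ae_tendsto_earlyPairs hmono.injective (by positivity)
    have hsame := ae_tendsto_sameLabelPairs hC hQ hpp hp hK₅
      (fun k i hki => (Nat.le_add_left _ _).trans (hreq k i hki))
    have hG : ∀ᵐ β : UnitAddCircle, ∀ s : ℝ, 0 ≤ s → Tendsto (fun N : ℕ =>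
        (closePairs A (Finset.range N).offDiag (s / N) β : ℝ) / N) atTop (𝓝 (2 * s)) := by
      filter_upwards [hlate, hearly, hsame] with β h1 h2 h3 s hs
      exact tendsto_closePairs_of_cubes (fun a b => tendsto_closePairs_cubes (h1 a b) (h2 a b)
        (h3 _ (by positivity)) (tendsto_card_sameLabelPairs hp)) hs
    filter_upwards [ae_coe_of_ae hG] with α hα s hs
    simp_rw [pairCorrelation_fract, ha]
    exact hα s hs
  · exact gap_energy_bounds (fun N => initialEnergy_le hm1 hmr (by norm_num) hC hQ ha N)
      (fun k N hk => le_initialEnergy hm1 hmr (by norm_num) hC hQ ha hk) hN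

theorem antitoneOn_log_rpow :
    AntitoneOn (fun N : ℕ => (1 + Real.log N) ^ (-(3 / 4) : ℝ)) (Set.Ici 1) := by
  intro M hM N _ hMN
  have hM' : (1 : ℝ) ≤ M := by exact_mod_cast hM
  have h1 : Real.log M ≤ Real.log N := Real.log_le_log (by linarith) (by exact_mod_cast hMN)
  have h2 : 0 ≤ Real.log M := Real.log_nonneg hM'
  exact Real.rpow_le_rpow_of_nonpos (by linarith) (by linarith) (by norm_num)

/-- Cauchy condensation reduces the series to one whose terms are at least `(k + 1) ^ (-3/4)`. -/
theorem not_summable_log_rpow_div :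
    ¬ Summable fun N : ℕ => (1 + Real.log N) ^ (-(3 / 4) : ℝ) / (N : ℝ) := by
  rw [← summable_condensed_iff_of_nonneg]
  · intro h
    have h1 : Summable fun k : ℕ => ((k + 1 : ℕ) : ℝ) ^ (-(3 / 4) : ℝ) := by
      refine Summable.of_nonneg_of_le (fun k => by positivity) (fun k => ?_) h
      have hk : (0 : ℝ) ≤ k := by positivity
      have h2 := Real.log_two_lt_d9
      have h3 := Real.log_two_gt_d9
      push_cast
      rw [Real.log_pow, mul_div_cancel₀ _ (by positivity)]
      exact Real.rpow_le_rpow_of_nonpos (by positivity) (by nlinarith) (by norm_num)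
    rw [summable_nat_add_iff (f := fun k : ℕ => (k : ℝ) ^ (-(3 / 4) : ℝ)) 1,
      Real.summable_nat_rpow] at h1
    norm_num at h1
  · intro N
    have : 0 ≤ Real.log N := Real.log_natCast_nonneg N
    positivity
  · intro M N hM hMN
    have hM' : (0 : ℝ) < M := by exact_mod_cast hM
    have h : (1 + Real.log N) ^ (-(3 / 4) : ℝ) ≤ (1 + Real.log M) ^ (-(3 / 4) : ℝ) :=
      antitoneOn_log_rpow hM (hM.trans_le hMN) hMN
    have : 0 ≤ Real.log M := Real.log_natCast_nonneg M
    exact div_le_div₀ (by positivity) h hM' (by exact_mod_cast hMN)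

/-- For `N ≥ 2` one has `1 + log N ≤ 4 * log N` and `log 2 ^ ε ≤ log N ^ ε`. So the sequence of the
second part also serves every `ε` in the first, with a constant depending on `ε`. -/
theorem div_log_rpow_le {ε : ℝ} (hε : 0 < ε) {N : ℕ} (hN : 2 ≤ N) :
    Real.log 2 ^ ε / 6 * ((N : ℝ) ^ 3 / Real.log N ^ (3 / 4 + ε)) ≤
      (N : ℝ) ^ 3 * (1 + Real.log N) ^ (-(3 / 4) : ℝ) := by
  have hN' : (2 : ℝ) ≤ N := by exact_mod_cast hN
  have h2 := Real.log_two_gt_d9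
  have h1 : Real.log 2 ≤ Real.log N := Real.log_le_log (by norm_num) hN'
  have hL : 0 < Real.log N := by linarith
  have h4 : (1 + Real.log N) ^ (3 / 4 : ℝ) ≤ 4 * Real.log N ^ (3 / 4 : ℝ) := by
    have h5 := rpow_le_two_mul (x := 1 + Real.log N) (y := 2 * Real.log N) (by positivity)
      (by positivity) (by linarith)
    have h6 := rpow_le_two_mul (x := 2 * Real.log N) (y := Real.log N) (by positivity)
      (by positivity) le_rfl
    linarith
  have h3 : Real.log 2 ^ ε ≤ Real.log N ^ ε := by gcongr
  rw [Real.rpow_add hL, Real.rpow_neg (by positivity), ← div_eq_mul_inv, ← mul_div_assoc,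
    div_le_div_iff₀ (by positivity) (by positivity)]
  have h7 : 0 < Real.log N ^ (3 / 4 : ℝ) := by positivity
  have h8 : 0 < Real.log 2 ^ ε := by positivity
  calc Real.log 2 ^ ε / 6 * (N : ℝ) ^ 3 * (1 + Real.log N) ^ (3 / 4 : ℝ)
      ≤ Real.log N ^ ε / 6 * (N : ℝ) ^ 3 * (4 * Real.log N ^ (3 / 4 : ℝ)) := by gcongr
    _ = (4 / 6) * ((N : ℝ) ^ 3 * (Real.log N ^ (3 / 4 : ℝ) * Real.log N ^ ε)) := by ring
    _ ≤ 1 * ((N : ℝ) ^ 3 * (Real.log N ^ (3 / 4 : ℝ) * Real.log N ^ ε)) := by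
        gcongr
        norm_num
    _ = _ := one_mul _

theorem theorem1 :
    (∀ ε : ℝ, 0 < ε →
      ∃ a : ℕ → ℕ, StrictMono a ∧ (∀ n, 0 < a n) ∧
        MetricPairCorrelationProperty a ∧
        ∃ c : ℝ, 0 < c ∧ ∀ N : ℕ, 2 ≤ N →
          c * ((N : ℝ) ^ 3 / Real.log N ^ (3 / 4 + ε)) ≤ (initialEnergy a N : ℝ)) ∧
    (∃ a : ℕ → ℕ, StrictMono a ∧ (∀ n, 0 < a n) ∧
      ∃ ψ : ℕ → ℝ, AntitoneOn ψ (Set.Ici 1) ∧ (∀ N, 1 ≤ N → ψ N ∈ Set.Icc (0 : ℝ) 1) ∧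
        (∃ c C : ℝ, 0 < c ∧ 0 < C ∧ ∀ N : ℕ, 1 ≤ N →
          c * ((N : ℝ) ^ 3 * ψ N) ≤ (initialEnergy a N : ℝ) ∧
          (initialEnergy a N : ℝ) ≤ C * ((N : ℝ) ^ 3 * ψ N)) ∧
        MetricPairCorrelationProperty a ∧
        ¬ Summable fun N : ℕ => ψ N / (N : ℝ)) := by
  obtain ⟨a, hmono, hpos, hmetric, c, D, hc, hD, hE⟩ := exists_metric_sequence
  refine ⟨fun ε hε => ⟨a, hmono, hpos, hmetric, c * (Real.log 2 ^ ε / 6),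
    by have := Real.log_pos one_lt_two; positivity, fun N hN => ?_⟩,
    a, hmono, hpos, fun N => (1 + Real.log N) ^ (-(3 / 4) : ℝ), antitoneOn_log_rpow,
    fun N hN => ?_, ⟨c, D, hc, hD, hE⟩, hmetric, not_summable_log_rpow_div⟩
  · rw [mul_assoc]
    exact (mul_le_mul_of_nonneg_left (div_log_rpow_le hε hN) hc.le).trans (hE N (by omega)).1
  · have h : 0 ≤ Real.log N := Real.log_natCast_nonneg N
    exact ⟨by positivity, Real.rpow_le_one_of_one_le_of_nonpos (by linarith) (by norm_num)⟩
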